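/- All Hilbert spaces are finite-dimensional and logarithms are to base $2$. A quantum channel is a completely positive trace-preserving linear map, a state is a positive semidefinite operator of unit trace, $H(\rho)=-\operatorname{tr}\rho\log\rho$, and for a bipartite state $I(A{:}B)_\rho=D(\rho_{AB}\,\|\,\rho_A\otimes\rho_B)$ with $D(\rho\|\sigma)=\operatorname{tr}[\rho(\log\rho-\log\sigma)]$. Let $\rho_{E_AE_B}$ be a bipartite state and $\mathcal N_{A\to B}$ a quantum channel. Put $$\chi_\rho(\mathcal N)=\max_{\omega}I(X{:}BE_B)_\omega,\qquad I_\rho(\mathcal N)=\max_{\omega}I(XE_B{:}B)_\omega,$$ where both maxima range over all states $$\omega_{XBE_B}=\sum_{x\in\mathcal X}p_X(x)\,|x\rangle\langle x|_X\otimes(\mathcal N_{A\to B}\circ\mathcal E^x_{E_A\to A})(\rho_{E_AE_B})$$ with $\mathcal X$ a finite alphabet (of any size), $p_X$ a probability distribution on $\mathcal X$, and $\mathcal E^x_{E_A\to A}$ quantum channels (the maps act as the identity on $E_B$). **Proposition.** Let $G$ be a compact group, let $f_A$ and $f_B$ be continuous projective unitary representations of $G$ on $\mathcal H_A$ and $\mathcal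 H_B$ with $f_A$ irreducible (continuity meaning that of the induced action $g\mapsto f(g)Mf(g)^\dagger$ for every operator $M$), and suppose that $\mathcal N_{A\to B}$ is covariant: $\mathcal N(f_A(g)Mf_A(g)^\dagger)=f_B(g)\mathcal N(M)f_B(g)^\dagger$ for all $g\in G$ and all operators $M$ on $\mathcal H_A$. Then for every bipartite state $\rho_{E_AE_B}$, pure or not, the two maxima above and the minimum below are attained, and $$\chi_\rho(\mathcal N)=I_\rho(\mathcal N)=H(\mathcal N(\pi_A))+H(\rho_{E_B})-\min_{\mathcal E_{E_A\to A}}H\big((\mathcal N\circ\mathcal E)(\rho_{E_AE_B})\big),$$ where $\pi_A=\mathbb 1/\dim\mathcal H_A$ is the maximally mixed state and the minimum is over all quantum channels $\mathcal E$ from $E_A$ to $A$. -/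

import Mathlib

open scoped Matrix Kronecker ComplexOrder

namespace QInfo

noncomputable section

variable {a b e r : Type*} [Fintype a] [DecidableEq a] [Fintype b] [DecidableEq b]
  [Fintype e] [DecidableEq e] [Fintype r] [DecidableEq r]

/-! ### States, partial traces and entropies

A finite-dimensional system is `ℂ^a` for a finite index type `a`; operators on it are matrices
`Matrix a a ℂ`, and a composite system is indexed by the product type. -/

/-- Quantum states: positive semidefinite operators of unit trace. -/
structure IsState (ρ : Matrix a a ℂ) : Prop where
  posSemidef : ρ.PosSemidef
  trace_eq_one : ρ.trace = 1

/-- The marginal on the first factor (partial trace over the second one). -/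
def marginalFst (M : Matrix (a × b) (a × b) ℂ) : Matrix a a ℂ :=
  Matrix.of fun i j => ∑ k, M (i, k) (j, k)

/-- The marginal on the second factor (partial trace over the first one). -/
def marginalSnd (M : Matrix (a × b) (a × b) ℂ) : Matrix b b ℂ :=
  Matrix.of fun k l => ∑ i, M (i, k) (i, l)

/-- The maximally mixed state. -/
def maxMixed (a : Type*) [Fintype a] [DecidableEq a] : Matrix a a ℂ :=
  (Fintype.card a : ℂ)⁻¹ • (1 : Matrix a a ℂ)

/-- The base-2 logarithm of a positive semidefinite operator, taken on its support: functional
calculus with `Real.logb 2`, for which `Real.logb 2 0 = 0`. -/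
def log2 (ρ : Matrix a a ℂ) : Matrix a a ℂ :=
  cfc (Real.logb 2) ρ

/-- The quantum entropy `H(ρ) = - tr ρ log ρ`. -/
def entropy (ρ : Matrix a a ℂ) : ℝ :=
  -(ρ * log2 ρ).trace.re

/-- The quantum relative entropy `D(ρ‖σ) = tr [ρ (log ρ - log σ)]`. This is its value when the
support of `ρ` is contained in that of `σ`; it is used only for `σ` the product of the two
marginals of `ρ`, where the containment always holds. -/
def relEntropy (ρ σ : Matrix a a ℂ) : ℝ :=
  (ρ * (log2 ρ - log2 σ)).trace.re

/-- The quantum mutual information `I(A:B)_ρ = D(ρ_AB ‖ ρ_A ⊗ ρ_B)`. -/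
def mutualInfo (ρ : Matrix (a × b) (a × b) ℂ) : ℝ :=
  relEntropy ρ (marginalFst ρ ⊗ₖ marginalSnd ρ)

/-! ### Channels -/

/-- The map `N ⊗ id_R`, acting on the first factor of a composite system. -/
def tensorId (N : Matrix a a ℂ →ₗ[ℂ] Matrix b b ℂ) (r : Type*) :
    Matrix (a × r) (a × r) ℂ →ₗ[ℂ] Matrix (b × r) (b × r) ℂ where
  toFun M := Matrix.of fun p q => N (Matrix.of fun i j => M (i, p.2) (j, q.2)) p.1 q.1
  map_add' M M' := by
    ext p q
    exact congrFun (congrFun (N.map_add (Matrix.of fun i j => M (i, p.2) (j, q.2))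
      (Matrix.of fun i j => M' (i, p.2) (j, q.2))) p.1) q.1
  map_smul' c M := by
    ext p q
    exact congrFun (congrFun (N.map_smul c (Matrix.of fun i j => M (i, p.2) (j, q.2))) p.1) q.1

/-- Quantum channels: completely positive, trace-preserving linear maps. -/
structure IsChannel (N : Matrix a a ℂ →ₗ[ℂ] Matrix b b ℂ) : Prop where
  completelyPositive : ∀ (n : ℕ) (M : Matrix (a × Fin n) (a × Fin n) ℂ),
    M.PosSemidef → (tensorId N (Fin n) M).PosSemidef
  tracePreserving : ∀ M : Matrix a a ℂ, (N M).trace = M.trace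

/-! ### State-assisted Holevo and mutual information of a channel -/

/-- The classical-quantum state `∑ x, p x |x⟩⟨x| ⊗ σ x`. -/
def cqState {n : ℕ} (p : Fin n → ℝ) (σ : Fin n → Matrix r r ℂ) :
    Matrix (Fin n × r) (Fin n × r) ℂ :=
  ∑ x, (p x : ℂ) • (Matrix.single x x (1 : ℂ) ⊗ₖ σ x)

/-- The states `ω_{X B E_B} = ∑ x, p x |x⟩⟨x| ⊗ (N ∘ 𝓔ˣ)(ρ)` on `X ⊗ (B ⊗ E_B)`, for an alphabet
`X` with `n` letters, a probability distribution `p` on it, and encoding channels `𝓔ˣ` from `E_A`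
to `A`. Here `e` indexes `E_A` and `r` indexes `E_B`. -/
def encodedStates (ρ : Matrix (e × r) (e × r) ℂ) (N : Matrix a a ℂ →ₗ[ℂ] Matrix b b ℂ) (n : ℕ) :
    Set (Matrix (Fin n × (b × r)) (Fin n × (b × r)) ℂ) :=
  {ω | ∃ (p : Fin n → ℝ) (E : Fin n → (Matrix e e ℂ →ₗ[ℂ] Matrix a a ℂ)),
    (∀ x, 0 ≤ p x) ∧ ∑ x, p x = 1 ∧ (∀ x, IsChannel (E x)) ∧
    ω = cqState p fun x => tensorId N r (tensorId (E x) r ρ)}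

/-- Regroup `X ⊗ (B ⊗ E_B)` as `(X ⊗ E_B) ⊗ B`. -/
def regroup {x : Type*} (ω : Matrix (x × (b × r)) (x × (b × r)) ℂ) :
    Matrix ((x × r) × b) ((x × r) × b) ℂ :=
  ω.submatrix (fun q => (q.1.1, (q.2, q.1.2))) (fun q => (q.1.1, (q.2, q.1.2)))

/-- The values `I(X : B E_B)_ω` over which the `ρ`-assisted Holevo information is the maximum. -/
def holevoValues (ρ : Matrix (e × r) (e × r) ℂ) (N : Matrix a a ℂ →ₗ[ℂ] Matrix b b ℂ) : Set ℝ :=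
  {v | ∃ n : ℕ, ∃ ω ∈ encodedStates ρ N n, v = mutualInfo ω}

/-- The values `I(X E_B : B)_ω` over which the `ρ`-assisted mutual information is the maximum. -/
def mutualValues (ρ : Matrix (e × r) (e × r) ℂ) (N : Matrix a a ℂ →ₗ[ℂ] Matrix b b ℂ) : Set ℝ :=
  {v | ∃ n : ℕ, ∃ ω ∈ encodedStates ρ N n, v = mutualInfo (regroup ω)}

/-- The `ρ`-assisted Holevo information `χ_ρ(N)` of a channel `N`. -/
def assistedHolevo (ρ : Matrix (e × r) (e × r) ℂ) (N : Matrix a a ℂ →ₗ[ℂ] Matrix b b ℂ) : ℝ :=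
  sSup (holevoValues ρ N)

/-- The `ρ`-assisted mutual information `I_ρ(N)` of a channel `N`. -/
def assistedMutual (ρ : Matrix (e × r) (e × r) ℂ) (N : Matrix a a ℂ →ₗ[ℂ] Matrix b b ℂ) : ℝ :=
  sSup (mutualValues ρ N)

/-- The values `H((N ∘ 𝓔)(ρ))`, where `𝓔` ranges over all channels from `E_A` to `A`. -/
def outputEntropies (ρ : Matrix (e × r) (e × r) ℂ) (N : Matrix a a ℂ →ₗ[ℂ] Matrix b b ℂ) : Set ℝ :=
  {h | ∃ E : Matrix e e ℂ →ₗ[ℂ] Matrix a a ℂ, IsChannel E ∧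
    h = entropy (tensorId N r (tensorId E r ρ))}

/-- The minimum `min_𝓔 H((N ∘ 𝓔)(ρ))`. -/
def minOutputEntropy (ρ : Matrix (e × r) (e × r) ℂ) (N : Matrix a a ℂ →ₗ[ℂ] Matrix b b ℂ) : ℝ :=
  sInf (outputEntropies ρ N)

/-! ### Covariance -/

/-- A (continuous, finite-dimensional) projective unitary representation: it is multiplicative up
to phases, and the induced action by conjugation is continuous. Continuous unitary
representations are the case where every phase is `1`. -/
structure IsProjectiveRep {G : Type*} [Group G] [TopologicalSpace G]
    (f : G → Matrix.unitaryGroup a ℂ) : Prop where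
  mul_phase : ∀ g h, ∃ c : ℂ, ‖c‖ = 1 ∧
    (f g : Matrix a a ℂ) * (f h : Matrix a a ℂ) = c • (f (g * h) : Matrix a a ℂ)
  continuous_conj : ∀ M : Matrix a a ℂ,
    Continuous fun g => (f g : Matrix a a ℂ) * M * (f g : Matrix a a ℂ)ᴴ

/-- Irreducibility: the space is nonzero and has no invariant subspaces but `0` and itself. -/
structure IsIrreducibleRep {G : Type*} (f : G → Matrix.unitaryGroup a ℂ) : Prop where
  nonempty : Nonempty a
  eq_bot_or_eq_top : ∀ W : Submodule ℂ (a → ℂ),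
    (∀ g, ∀ v ∈ W, (f g : Matrix a a ℂ) *ᵥ v ∈ W) → W = ⊥ ∨ W = ⊤

/-- Covariance: `N (f_A(g) M f_A(g)†) = f_B(g) N(M) f_B(g)†` for all `g` and `M`. -/
def IsCovariant {G : Type*} (fA : G → Matrix.unitaryGroup a ℂ) (fB : G → Matrix.unitaryGroup b ℂ)
    (N : Matrix a a ℂ →ₗ[ℂ] Matrix b b ℂ) : Prop :=
  ∀ (g : G) (M : Matrix a a ℂ),
    N ((fA g : Matrix a a ℂ) * M * (fA g : Matrix a a ℂ)ᴴ) =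
      (fB g : Matrix b b ℂ) * N M * (fB g : Matrix b b ℂ)ᴴ

end

end QInfo

/-!
Both information quantities of a classical-quantum state are differences of entropies. For an
ensemble of outputs `σ x` with weights `p x`, `I(X : B E_B)` is the entropy of the average output
minus the average of the entropies (`mutualInfo_cqState`), and since encodings do not touch `E_B`,
`I(X E_B : B)` is `H(B) + H(E_B)` minus the same average (`mutualInfo_regroup_cqState`). By
subadditivity (`entropy_le_add_marginals`) the first is at most the second.

The average entropy is at least the minimal output entropy, and `H(B)` is at most `H(N(π))`: the
state `N(π)` is an average of unitary conjugates of any output `N(σ)`, because averaging over the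
irreducible representation sends every state to `π`, and the entropy is concave
(`IsCovariant.entropy_apply_le`). This gives the upper bound for both quantities. It is attained by
composing one optimal encoding with the twirl: the output entropies do not change, and the average
output becomes `N(π) ⊗ ρ_{E_B}` (`average_twirled_output`).

Three points carry the rest.
* Alphabets are finite, so the twirl has to be a finite average. The convex hull of the conjugations
  is compact by Carathéodory's theorem, so it has an element of least Hilbert–Schmidt norm; by
  uniqueness that element is invariant, and Schur's lemma identifies it (`exists_twirl`). No
  integration over the group is needed.
* Marginals may be singular, and the logarithm is then taken on the support. Entropy inequalities
  are therefore derived from the fact that measuring in an orthonormal basis does not decrease the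
  entropy (`entropy_le_sum_diag`), which reduces them to statements about probability vectors.
* The minimal output entropy is attained since channels form a compact set
  (`isCompact_setOf_isChannel`) and the entropy is continuous on states (`continuousOn_entropy`).
-/

set_option linter.unusedSectionVars false

namespace QInfo

/-! ### Diagonalised operators and their entropy -/

section Spectral

variable {a b : Type*} [Fintype a] [DecidableEq a] [Fintype b] [DecidableEq b]

/-- The summand `-x log x` (base 2) of the Shannon entropy. -/
noncomputable def entropyTerm (x : ℝ) : ℝ := Real.negMulLog x / Real.log 2

lemma entropyTerm_eq (x : ℝ) : entropyTerm x = -(x * Real.logb 2 x) := by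
  simp only [entropyTerm, Real.negMulLog, Real.logb]
  ring

lemma concaveOn_entropyTerm : ConcaveOn ℝ (Set.Ici 0) entropyTerm := by
  have h := Real.concaveOn_negMulLog.smul (c := (Real.log 2)⁻¹)
    (inv_nonneg.2 (Real.log_nonneg one_le_two))
  refine h.congr fun x _ => ?_
  simp [entropyTerm, div_eq_inv_mul]

lemma entropyTerm_mul (x y : ℝ) :
    entropyTerm (x * y) = y * entropyTerm x + x * entropyTerm y := by
  simp only [entropyTerm, Real.negMulLog_mul]
  ring

/-- The operator `U diag(d) U†`. -/
noncomputable def conjDiag (U : Matrix a a ℂ) (d : a → ℝ) : Matrix a a ℂ :=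
  U * Matrix.diagonal (fun i => (d i : ℂ)) * Uᴴ

lemma conjDiag_one (d : a → ℝ) : conjDiag 1 d = Matrix.diagonal fun i => (d i : ℂ) := by
  simp [conjDiag]

lemma conjTranspose_mul_self_of_mem {U : Matrix a a ℂ} (hU : U ∈ Matrix.unitaryGroup a ℂ) :
    Uᴴ * U = 1 :=
  Matrix.mem_unitaryGroup_iff'.1 hU

lemma self_mul_conjTranspose_of_mem {U : Matrix a a ℂ} (hU : U ∈ Matrix.unitaryGroup a ℂ) :
    U * Uᴴ = 1 :=
  Matrix.mem_unitaryGroup_iff.1 hU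

lemma conj_conjDiag (V U : Matrix a a ℂ) (d : a → ℝ) :
    V * conjDiag U d * Vᴴ = conjDiag (V * U) d := by
  simp [conjDiag, Matrix.mul_assoc]

lemma exists_eq_conjDiag {ρ : Matrix a a ℂ} (hρ : ρ.IsHermitian) :
    ∃ U ∈ Matrix.unitaryGroup a ℂ, ∃ d : a → ℝ, ρ = conjDiag U d := by
  refine ⟨hρ.eigenvectorUnitary, hρ.eigenvectorUnitary.2, hρ.eigenvalues, ?_⟩
  conv_lhs => rw [hρ.spectral_theorem]
  rfl

lemma eq_of_conjDiag {U : Matrix a a ℂ} (hU : U ∈ Matrix.unitaryGroup a ℂ) {ρ : Matrix a a ℂ}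
    {d : a → ℝ} (h : ρ = conjDiag U d) (i : a) : (Uᴴ * ρ * U) i i = d i := by
  have : Uᴴ * ρ * U = (Uᴴ * U) * Matrix.diagonal (fun i => (d i : ℂ)) * (Uᴴ * U) := by
    simp [h, conjDiag, Matrix.mul_assoc]
  rw [this, conjTranspose_mul_self_of_mem hU]
  simp

lemma nonneg_of_conjDiag {U : Matrix a a ℂ} (hU : U ∈ Matrix.unitaryGroup a ℂ)
    {ρ : Matrix a a ℂ} (hρ : ρ.PosSemidef) {d : a → ℝ} (h : ρ = conjDiag U d) (i : a) :
    0 ≤ d i := by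
  have h1 := (hρ.conjTranspose_mul_mul_same U).diag_nonneg (i := i)
  rw [eq_of_conjDiag hU h i] at h1
  exact_mod_cast h1

lemma trace_conjDiag {U : Matrix a a ℂ} (hU : U ∈ Matrix.unitaryGroup a ℂ) (d : a → ℝ) :
    (conjDiag U d).trace = ∑ i, (d i : ℂ) := by
  rw [conjDiag, Matrix.trace_mul_cycle, conjTranspose_mul_self_of_mem hU, one_mul,
    Matrix.trace_diagonal]

/-- The functional calculus of a diagonalised operator acts on the diagonal. -/
lemma cfc_conjDiag {U : Matrix a a ℂ} (hU : U ∈ Matrix.unitaryGroup a ℂ) (f : ℝ → ℝ)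
    (d : a → ℝ) : cfc f (conjDiag U d) = conjDiag U (f ∘ d) := by
  -- On the finitely many values of `d`, `f` is a polynomial, and `conjDiag U` is an algebra map.
  have hU' := conjTranspose_mul_self_of_mem hU
  have hU'' := self_mul_conjTranspose_of_mem hU
  let φ : (a → ℝ) →ₐ[ℝ] Matrix a a ℂ :=
    { toFun := conjDiag U
      map_one' := by simp [conjDiag, hU'']
      map_mul' := fun x y => by
        have h : conjDiag U x * conjDiag U y
            = U * Matrix.diagonal (fun i => (x i : ℂ)) * (Uᴴ * U)
              * Matrix.diagonal (fun i => (y i : ℂ)) * Uᴴ := by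
          simp only [conjDiag, Matrix.mul_assoc]
        rw [h, hU', mul_one, Matrix.mul_assoc U, Matrix.diagonal_mul_diagonal]
        simp [conjDiag]
      map_zero' := by simp [conjDiag]
      map_add' := fun x y => by
        simp only [conjDiag, Pi.add_apply, Complex.ofReal_add, ← Matrix.diagonal_add,
          Matrix.mul_add, Matrix.add_mul]
      commutes' := fun c => by
        have : (Matrix.diagonal fun i : a => (((algebraMap ℝ (a → ℝ)) c i : ℝ) : ℂ))
            = c • (1 : Matrix a a ℂ) := by
          ext i j
          simp [Matrix.diagonal, Matrix.one_apply]
        rw [conjDiag, this, Matrix.mul_smul, mul_one, Matrix.smul_mul, hU'',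
          Algebra.algebraMap_eq_smul_one] }
  have hφ : ∀ x, φ x = conjDiag U x := fun _ => rfl
  let p : Polynomial ℝ := Lagrange.interpolate (Finset.univ.image d) id f
  have hp : ∀ i, p.eval (d i) = f (d i) := fun i =>
    Lagrange.eval_interpolate_at_node f (Set.injOn_id _)
      (Finset.mem_image_of_mem d (Finset.mem_univ i))
  have hsa : IsSelfAdjoint (conjDiag U d) := by
    change (conjDiag U d).IsHermitian
    rw [Matrix.IsHermitian, conjDiag]
    simp only [Matrix.conjTranspose_mul, Matrix.conjTranspose_conjTranspose,
      Matrix.diagonal_conjTranspose, Matrix.mul_assoc]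
    congr 3
    ext i
    simp
  have hspec : (spectrum ℝ (conjDiag U d)).EqOn f p.eval := by
    intro x hx
    have h1 := AlgHom.spectrum_apply_subset φ d hx
    rw [Pi.spectrum_eq] at h1
    obtain ⟨i, hi⟩ := Set.mem_iUnion.1 h1
    have : x = d i := by
      simpa [spectrum.mem_iff, sub_eq_zero] using hi
    exact this ▸ (hp i).symm
  rw [cfc_congr hspec, cfc_polynomial p (conjDiag U d), ← hφ, ← hφ, Polynomial.aeval_algHom_apply]
  congr 1
  ext i
  have := Polynomial.aeval_algHom_apply (Pi.evalAlgHom ℝ (fun _ : a => ℝ) i) d p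
  simp only [Pi.evalAlgHom_apply] at this
  rw [← this, Polynomial.coe_aeval_eq_eval, hp]
  rfl

lemma log2_conjDiag {U : Matrix a a ℂ} (hU : U ∈ Matrix.unitaryGroup a ℂ) (d : a → ℝ) :
    log2 (conjDiag U d) = conjDiag U (Real.logb 2 ∘ d) :=
  cfc_conjDiag hU _ d

lemma trace_mul_conjDiag (ρ U : Matrix a a ℂ) (d : a → ℝ) :
    (ρ * conjDiag U d).trace.re = ∑ i, ((Uᴴ * ρ * U) i i).re * d i := by
  have : ρ * conjDiag U d = ρ * U * Matrix.diagonal (fun i => (d i : ℂ)) * Uᴴ := by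
    simp only [conjDiag, Matrix.mul_assoc]
  rw [this, Matrix.trace_mul_comm, ← Matrix.mul_assoc, ← Matrix.mul_assoc, Matrix.trace]
  simp [Matrix.mul_diagonal]

lemma entropy_conjDiag {U : Matrix a a ℂ} (hU : U ∈ Matrix.unitaryGroup a ℂ) (d : a → ℝ) :
    entropy (conjDiag U d) = ∑ i, entropyTerm (d i) := by
  rw [entropy, log2_conjDiag hU, trace_mul_conjDiag, ← Finset.sum_neg_distrib]
  refine Finset.sum_congr rfl fun i _ => ?_
  rw [eq_of_conjDiag hU rfl i, entropyTerm_eq]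
  rfl

lemma entropy_conj_unitary {V : Matrix a a ℂ} (hV : V ∈ Matrix.unitaryGroup a ℂ)
    {ρ : Matrix a a ℂ} (hρ : ρ.IsHermitian) : entropy (V * ρ * Vᴴ) = entropy ρ := by
  obtain ⟨U, hU, d, rfl⟩ := exists_eq_conjDiag hρ
  rw [conj_conjDiag, entropy_conjDiag hU, entropy_conjDiag (mul_mem hV hU)]

lemma submatrix_mem_unitaryGroup {U : Matrix a a ℂ} (hU : U ∈ Matrix.unitaryGroup a ℂ)
    (f : b ≃ a) : U.submatrix f f ∈ Matrix.unitaryGroup b ℂ := by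
  rw [Matrix.mem_unitaryGroup_iff, Matrix.star_eq_conjTranspose, Matrix.conjTranspose_submatrix,
    Matrix.submatrix_mul_equiv, self_mul_conjTranspose_of_mem hU, Matrix.submatrix_one_equiv]

lemma entropy_submatrix_equiv {ρ : Matrix a a ℂ} (hρ : ρ.IsHermitian) (f : b ≃ a) :
    entropy (ρ.submatrix f f) = entropy ρ := by
  obtain ⟨U, hU, d, rfl⟩ := exists_eq_conjDiag hρ
  have : (conjDiag U d).submatrix f f = conjDiag (U.submatrix f f) (d ∘ f) := by
    have hd : Matrix.diagonal (fun i => ((d ∘ f) i : ℂ))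
        = (Matrix.diagonal fun i => (d i : ℂ)).submatrix f f := by
      rw [Matrix.submatrix_diagonal_equiv]
      rfl
    rw [conjDiag, conjDiag, hd, Matrix.conjTranspose_submatrix, Matrix.submatrix_mul_equiv,
      Matrix.submatrix_mul_equiv]
  rw [this, entropy_conjDiag hU, entropy_conjDiag (submatrix_mem_unitaryGroup hU f)]
  exact Equiv.sum_comp f fun i => entropyTerm (d i)

/-! ### Measuring in a basis and concavity -/

/-- The entropy of a state is at most the Shannon entropy of its diagonal in any orthonormal
basis. -/
lemma entropy_le_sum_diag {ρ : Matrix a a ℂ} (hρ : ρ.PosSemidef) {V : Matrix a a ℂ}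
    (hV : V ∈ Matrix.unitaryGroup a ℂ) :
    entropy ρ ≤ ∑ i, entropyTerm ((Vᴴ * ρ * V) i i).re := by
  obtain ⟨U, hU, d, hd⟩ := exists_eq_conjDiag hρ.isHermitian
  have hd0 := nonneg_of_conjDiag hU hρ hd
  -- The diagonal arises from the spectrum by the doubly stochastic matrix `|W i k|²`.
  have hVs : Vᴴ ∈ Matrix.unitaryGroup a ℂ := Unitary.star_mem hV
  have hW : Vᴴ * U ∈ Matrix.unitaryGroup a ℂ := mul_mem hVs hU
  set W := Vᴴ * U with hWdef
  have hconj : Vᴴ * ρ * V = conjDiag W d := by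
    have := conj_conjDiag Vᴴ U d
    rw [Matrix.conjTranspose_conjTranspose] at this
    rw [hd, this]
  have hentry : ∀ i, (conjDiag W d i i).re = ∑ k, ‖W i k‖ ^ 2 • d k := by
    intro i
    rw [conjDiag, Matrix.mul_apply, Complex.re_sum]
    refine Finset.sum_congr rfl fun k _ => ?_
    rw [Matrix.mul_diagonal, Matrix.conjTranspose_apply, mul_right_comm, Complex.star_def,
      Complex.mul_conj, ← Complex.ofReal_mul, Complex.ofReal_re, Complex.normSq_eq_norm_sq,
      smul_eq_mul]
  have hrow : ∀ i, ∑ k, ‖W i k‖ ^ 2 = 1 := by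
    intro i
    have := congrFun (congrFun (self_mul_conjTranspose_of_mem hW) i) i
    rw [Matrix.mul_apply, Matrix.one_apply_eq] at this
    have h2 : ∀ k, W i k * Wᴴ k i = ((‖W i k‖ ^ 2 : ℝ) : ℂ) := fun k => by
      rw [Matrix.conjTranspose_apply, Complex.star_def, Complex.mul_conj,
        Complex.normSq_eq_norm_sq]
    simp only [h2] at this
    exact_mod_cast this
  have hcol : ∀ k, ∑ i, ‖W i k‖ ^ 2 = 1 := by
    intro k
    have := congrFun (congrFun (conjTranspose_mul_self_of_mem hW) k) k
    rw [Matrix.mul_apply, Matrix.one_apply_eq] at this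
    have h2 : ∀ i, Wᴴ k i * W i k = ((‖W i k‖ ^ 2 : ℝ) : ℂ) := fun i => by
      rw [Matrix.conjTranspose_apply, mul_comm, Complex.star_def, Complex.mul_conj,
        Complex.normSq_eq_norm_sq]
    simp only [h2] at this
    exact_mod_cast this
  calc entropy ρ = ∑ k, entropyTerm (d k) := by rw [hd, entropy_conjDiag hU]
    _ = ∑ k, (∑ i, ‖W i k‖ ^ 2) * entropyTerm (d k) := by simp [hcol]
    _ = ∑ i, ∑ k, ‖W i k‖ ^ 2 • entropyTerm (d k) := by
        simp only [Finset.sum_mul, smul_eq_mul]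
        exact Finset.sum_comm
    _ ≤ ∑ i, entropyTerm (∑ k, ‖W i k‖ ^ 2 • d k) :=
        Finset.sum_le_sum fun i _ => concaveOn_entropyTerm.le_map_sum
          (fun k _ => by positivity) (hrow i) (fun k _ => hd0 k)
    _ = ∑ i, entropyTerm ((Vᴴ * ρ * V) i i).re := by simp only [hconj, hentry]

lemma sum_smul_entropy_le {n : ℕ} {p : Fin n → ℝ} (hp : ∀ x, 0 ≤ p x) (hp1 : ∑ x, p x = 1)
    {σ : Fin n → Matrix a a ℂ} (hσ : ∀ x, (σ x).PosSemidef) :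
    ∑ x, p x * entropy (σ x) ≤ entropy (∑ x, (p x : ℂ) • σ x) := by
  have hpos : (∑ x, (p x : ℂ) • σ x).PosSemidef :=
    Matrix.posSemidef_sum _ fun x _ => (hσ x).smul (Complex.zero_le_real.2 (hp x))
  obtain ⟨U, hU, d, hd⟩ := exists_eq_conjDiag hpos.isHermitian
  have hdi : ∀ i, d i = ∑ x, p x • ((Uᴴ * σ x * U) i i).re := by
    intro i
    have := congrArg Complex.re (eq_of_conjDiag hU hd i)
    rw [Complex.ofReal_re] at this
    rw [← this, Matrix.mul_sum, Matrix.sum_mul, Matrix.sum_apply, Complex.re_sum]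
    simp
  calc ∑ x, p x * entropy (σ x)
      ≤ ∑ x, p x * ∑ i, entropyTerm ((Uᴴ * σ x * U) i i).re :=
        Finset.sum_le_sum fun x _ =>
          mul_le_mul_of_nonneg_left (entropy_le_sum_diag (hσ x) hU) (hp x)
    _ = ∑ i, ∑ x, p x • entropyTerm ((Uᴴ * σ x * U) i i).re := by
        simp only [Finset.mul_sum, smul_eq_mul]
        exact Finset.sum_comm
    _ ≤ ∑ i, entropyTerm (∑ x, p x • ((Uᴴ * σ x * U) i i).re) :=
        Finset.sum_le_sum fun i _ => concaveOn_entropyTerm.le_map_sum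
          (fun x _ => hp x) hp1 fun x _ =>
            (Complex.nonneg_iff.1 ((hσ x).conjTranspose_mul_mul_same U).diag_nonneg).1
    _ = entropy (∑ x, (p x : ℂ) • σ x) := by
        rw [hd, entropy_conjDiag hU]
        simp only [hdi]

end Spectral

/-! ### Mutual information and subadditivity -/

section Bipartite

variable {a b : Type*} [Fintype a] [DecidableEq a] [Fintype b] [DecidableEq b]

lemma kronecker_conjDiag (U : Matrix a a ℂ) (V : Matrix b b ℂ) (d : a → ℝ) (d' : b → ℝ) :
    conjDiag U d ⊗ₖ conjDiag V d' = conjDiag (U ⊗ₖ V) fun q => d q.1 * d' q.2 := by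
  simp only [conjDiag, Matrix.mul_kronecker_mul, Matrix.conjTranspose_kronecker,
    Matrix.diagonal_kronecker_diagonal, Complex.ofReal_mul]

lemma entropy_kronecker {A : Matrix a a ℂ} {B : Matrix b b ℂ} (hA : A.IsHermitian)
    (hB : B.IsHermitian) (hA1 : A.trace = 1) (hB1 : B.trace = 1) :
    entropy (A ⊗ₖ B) = entropy A + entropy B := by
  obtain ⟨U, hU, d, rfl⟩ := exists_eq_conjDiag hA
  obtain ⟨V, hV, d', rfl⟩ := exists_eq_conjDiag hB
  rw [trace_conjDiag hU] at hA1
  rw [trace_conjDiag hV] at hB1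
  have hd : ∑ i, d i = 1 := by exact_mod_cast hA1
  have hd' : ∑ j, d' j = 1 := by exact_mod_cast hB1
  rw [kronecker_conjDiag, entropy_conjDiag hU, entropy_conjDiag hV,
    entropy_conjDiag (Matrix.kronecker_mem_unitary hU hV), Fintype.sum_prod_type]
  simp only [entropyTerm_mul, Finset.sum_add_distrib, ← Finset.sum_mul, ← Finset.mul_sum, hd, hd',
    one_mul]

lemma marginalFst_kronecker_conj (U : Matrix a a ℂ) {V : Matrix b b ℂ}
    (hV : V ∈ Matrix.unitaryGroup b ℂ) (M : Matrix (a × b) (a × b) ℂ) :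
    marginalFst ((U ⊗ₖ V)ᴴ * M * (U ⊗ₖ V)) = Uᴴ * marginalFst M * U := by
  have hV' : ∀ k l, ∑ j, V k j * star (V l j) = if k = l then 1 else 0 := fun k l => by
    have := congrFun (congrFun (self_mul_conjTranspose_of_mem hV) k) l
    rwa [Matrix.mul_apply, Matrix.one_apply] at this
  ext i i'
  simp only [marginalFst, Matrix.of_apply, Matrix.mul_apply, Matrix.conjTranspose_apply,
    Matrix.kroneckerMap_apply, Fintype.sum_prod_type, star_mul', Finset.sum_mul, Finset.mul_sum]
  rw [Finset.sum_comm]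
  refine Finset.sum_congr rfl fun y _ => ?_
  calc _ = ∑ k, ∑ x, ∑ l, star (U x i) * M (x, l) (y, k) * U y i'
              * ∑ j, V k j * star (V l j) := by
        rw [Finset.sum_comm]
        refine Finset.sum_congr rfl fun k _ => ?_
        rw [Finset.sum_comm]
        refine Finset.sum_congr rfl fun x _ => ?_
        rw [Finset.sum_comm]
        refine Finset.sum_congr rfl fun l _ => ?_
        rw [Finset.mul_sum]
        exact Finset.sum_congr rfl fun j _ => by ring
    _ = _ := by
        rw [Finset.sum_comm]
        simp only [hV', mul_ite, mul_one, mul_zero, Finset.sum_ite_eq, Finset.mem_univ, if_true]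

lemma marginalSnd_eq_marginalFst (M : Matrix (a × b) (a × b) ℂ) :
    marginalSnd M = marginalFst (M.submatrix (Equiv.prodComm b a) (Equiv.prodComm b a)) := rfl

lemma marginalSnd_kronecker_conj {U : Matrix a a ℂ} (hU : U ∈ Matrix.unitaryGroup a ℂ)
    (V : Matrix b b ℂ) (M : Matrix (a × b) (a × b) ℂ) :
    marginalSnd ((U ⊗ₖ V)ᴴ * M * (U ⊗ₖ V)) = Vᴴ * marginalSnd M * V := by
  have hsw : (U ⊗ₖ V).submatrix (Equiv.prodComm b a) (Equiv.prodComm b a) = V ⊗ₖ U := by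
    ext p q
    simp [mul_comm]
  rw [marginalSnd_eq_marginalFst, marginalSnd_eq_marginalFst, ← marginalFst_kronecker_conj V hU,
    ← hsw, Matrix.conjTranspose_submatrix, Matrix.submatrix_mul_equiv, Matrix.submatrix_mul_equiv]

lemma posSemidef_marginalFst {M : Matrix (a × b) (a × b) ℂ} (hM : M.PosSemidef) :
    (marginalFst M).PosSemidef := by
  have : marginalFst M = ∑ k, M.submatrix (fun i => (i, k)) (fun i => (i, k)) := by
    ext i j
    simp [marginalFst, Matrix.sum_apply]
  rw [this]
  exact Matrix.posSemidef_sum _ fun k _ => hM.submatrix _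

lemma posSemidef_marginalSnd {M : Matrix (a × b) (a × b) ℂ} (hM : M.PosSemidef) :
    (marginalSnd M).PosSemidef := by
  rw [marginalSnd_eq_marginalFst]
  exact posSemidef_marginalFst (hM.submatrix _)

lemma trace_marginalFst (M : Matrix (a × b) (a × b) ℂ) : (marginalFst M).trace = M.trace := by
  simp [marginalFst, Matrix.trace, Fintype.sum_prod_type]

lemma trace_marginalSnd (M : Matrix (a × b) (a × b) ℂ) : (marginalSnd M).trace = M.trace := by
  simp [marginalSnd, Matrix.trace, Fintype.sum_prod_type_right]

/-- The distribution of the outcomes of measuring a bipartite operator in the eigenbases of its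
marginals: its own marginals are the spectra of the marginals. -/
lemma exists_marginal_eigenbases {ρ : Matrix (a × b) (a × b) ℂ} (hρ : ρ.PosSemidef) :
    ∃ U ∈ Matrix.unitaryGroup a ℂ, ∃ V ∈ Matrix.unitaryGroup b ℂ, ∃ d : a → ℝ, ∃ d' : b → ℝ,
      marginalFst ρ = conjDiag U d ∧ marginalSnd ρ = conjDiag V d' ∧
      (∀ q, 0 ≤ (((U ⊗ₖ V)ᴴ * ρ * (U ⊗ₖ V)) q q).re) ∧
      (∀ i, ∑ j, (((U ⊗ₖ V)ᴴ * ρ * (U ⊗ₖ V)) (i, j) (i, j)).re = d i) ∧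
      (∀ j, ∑ i, (((U ⊗ₖ V)ᴴ * ρ * (U ⊗ₖ V)) (i, j) (i, j)).re = d' j) := by
  obtain ⟨U, hU, d, hd⟩ := exists_eq_conjDiag (posSemidef_marginalFst hρ).isHermitian
  obtain ⟨V, hV, d', hd'⟩ := exists_eq_conjDiag (posSemidef_marginalSnd hρ).isHermitian
  refine ⟨U, hU, V, hV, d, d', hd, hd', fun q => ?_, fun i => ?_, fun j => ?_⟩
  · exact (Complex.nonneg_iff.1 (hρ.conjTranspose_mul_mul_same _).diag_nonneg).1
  · have h := eq_of_conjDiag hU hd i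
    rw [← marginalFst_kronecker_conj U hV] at h
    simpa [marginalFst] using congrArg Complex.re h
  · have h := eq_of_conjDiag hV hd' j
    rw [← marginalSnd_kronecker_conj hU] at h
    simpa [marginalSnd] using congrArg Complex.re h

/-- `I(A:B) = H(A) + H(B) - H(AB)`. The logarithm of a product of marginals, taken on the support,
splits as a sum wherever the state has weight. -/
lemma mutualInfo_eq {ρ : Matrix (a × b) (a × b) ℂ} (hρ : ρ.PosSemidef) :
    mutualInfo ρ = entropy (marginalFst ρ) + entropy (marginalSnd ρ) - entropy ρ := by
  obtain ⟨U, hU, V, hV, d, d', hd, hd', hq, hq1, hq2⟩ := exists_marginal_eigenbases hρ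
  set q : a × b → ℝ := fun z => (((U ⊗ₖ V)ᴴ * ρ * (U ⊗ₖ V)) z z).re with hqdef
  have hlog : ∀ i j, q (i, j) * Real.logb 2 (d i * d' j)
      = q (i, j) * Real.logb 2 (d i) + q (i, j) * Real.logb 2 (d' j) := by
    intro i j
    rcases (hq (i, j)).eq_or_lt with h | h
    · have h' : q (i, j) = 0 := h.symm
      simp [h']
    · have h1 : d i ≠ 0 := by
        rw [← hq1 i]
        exact (h.trans_le (Finset.single_le_sum (f := fun j => q (i, j))
          (fun j _ => hq (i, j)) (Finset.mem_univ j))).ne'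
      have h2 : d' j ≠ 0 := by
        rw [← hq2 j]
        exact (h.trans_le (Finset.single_le_sum (f := fun i => q (i, j))
          (fun i _ => hq (i, j)) (Finset.mem_univ i))).ne'
      rw [Real.logb_mul h1 h2, mul_add]
  have hcross : (ρ * log2 (marginalFst ρ ⊗ₖ marginalSnd ρ)).trace.re
      = -entropy (marginalFst ρ) - entropy (marginalSnd ρ) := by
    rw [hd, hd', kronecker_conjDiag, log2_conjDiag (Matrix.kronecker_mem_unitary hU hV),
      trace_mul_conjDiag, entropy_conjDiag hU, entropy_conjDiag hV, Fintype.sum_prod_type]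
    change ∑ i, ∑ j, q (i, j) * Real.logb 2 (d i * d' j) = _
    simp only [hlog, Finset.sum_add_distrib]
    rw [Finset.sum_comm (f := fun i j => q (i, j) * Real.logb 2 (d' j))]
    simp only [← Finset.sum_mul]
    have h1 : ∀ i, ∑ j, q (i, j) = d i := hq1
    have h2 : ∀ j, ∑ i, q (i, j) = d' j := hq2
    simp only [h1, h2, entropyTerm_eq, Finset.sum_neg_distrib]
    ring
  rw [mutualInfo, relEntropy, mul_sub, Matrix.trace_sub, Complex.sub_re, hcross, entropy, entropy,
    entropy]
  ring

/-- Subadditivity of the entropy. -/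
lemma entropy_le_add_marginals {ρ : Matrix (a × b) (a × b) ℂ} (hρ : IsState ρ) :
    entropy ρ ≤ entropy (marginalFst ρ) + entropy (marginalSnd ρ) := by
  -- Measuring in the eigenbases of the marginals reduces this to the classical inequality.
  obtain ⟨U, hU, V, hV, d, d', hd, hd', hq, hq1, hq2⟩ := exists_marginal_eigenbases hρ.posSemidef
  have hUV := Matrix.kronecker_mem_unitary hU hV
  refine (entropy_le_sum_diag hρ.posSemidef hUV).trans ?_
  have htr : ∑ i, d i = 1 := by
    have := trace_conjDiag hU d
    rw [← hd, trace_marginalFst, hρ.trace_eq_one] at this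
    exact_mod_cast this.symm
  have htr' : ∑ j, d' j = 1 := by
    have := trace_conjDiag hV d'
    rw [← hd', trace_marginalSnd, hρ.trace_eq_one] at this
    exact_mod_cast this.symm
  set q : a × b → ℝ := fun z => (((U ⊗ₖ V)ᴴ * ρ * (U ⊗ₖ V)) z z).re with hqdef
  replace hq1 : ∀ i, ∑ j, q (i, j) = d i := hq1
  replace hq2 : ∀ j, ∑ i, q (i, j) = d' j := hq2
  replace hq : ∀ z, 0 ≤ q z := hq
  have hd0 : ∀ i, 0 ≤ d i := fun i => hq1 i ▸ Finset.sum_nonneg fun j _ => hq _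
  have hd0' : ∀ j, 0 ≤ d' j := fun j => hq2 j ▸ Finset.sum_nonneg fun i _ => hq _
  -- Gibbs' inequality, from `log t ≤ t - 1` with `t = d i * d' j / q (i, j)`.
  have hterm : ∀ i j, Real.negMulLog (q (i, j)) ≤
      -(q (i, j) * Real.log (d i)) - q (i, j) * Real.log (d' j) + (d i * d' j - q (i, j)) := by
    intro i j
    rcases (hq (i, j)).eq_or_lt with h | h
    · rw [← h]
      simpa using mul_nonneg (hd0 i) (hd0' j)
    · have h1 : 0 < d i := by
        rw [← hq1 i]
        exact h.trans_le (Finset.single_le_sum (f := fun j => q (i, j))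
          (fun j _ => hq (i, j)) (Finset.mem_univ j))
      have h2 : 0 < d' j := by
        rw [← hq2 j]
        exact h.trans_le (Finset.single_le_sum (f := fun i => q (i, j))
          (fun i _ => hq (i, j)) (Finset.mem_univ i))
      have h3 := Real.log_le_sub_one_of_pos (div_pos (mul_pos h1 h2) h)
      rw [Real.log_div (mul_pos h1 h2).ne' h.ne', Real.log_mul h1.ne' h2.ne'] at h3
      have h4 := mul_le_mul_of_nonneg_left h3 h.le
      have h5 : q (i, j) * (d i * d' j / q (i, j) - 1) = d i * d' j - q (i, j) := by
        field_simp
      rw [h5] at h4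
      rw [Real.negMulLog]
      linarith
  have hsum : ∑ i, ∑ j, Real.negMulLog (q (i, j)) ≤
      ∑ i, Real.negMulLog (d i) + ∑ j, Real.negMulLog (d' j) := by
    refine (Finset.sum_le_sum fun i _ => Finset.sum_le_sum fun j _ => hterm i j).trans
      (le_of_eq ?_)
    simp only [Finset.sum_add_distrib, Finset.sum_sub_distrib, Finset.sum_neg_distrib]
    rw [Finset.sum_comm (f := fun i j => q (i, j) * Real.log (d' j))]
    simp only [← Finset.sum_mul, ← Finset.mul_sum, hq1, hq2, htr, htr', Real.negMulLog,
      Finset.sum_neg_distrib, neg_mul]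
    ring
  rw [hd, hd', entropy_conjDiag hU, entropy_conjDiag hV, Fintype.sum_prod_type]
  simp only [entropyTerm, ← Finset.sum_div, ← add_div]
  exact div_le_div_of_nonneg_right hsum (Real.log_nonneg one_le_two)

end Bipartite

/-! ### Classical-quantum states -/

section ClassicalQuantum

variable {a b r : Type*} [Fintype a] [DecidableEq a] [Fintype b] [DecidableEq b]
  [Fintype r] [DecidableEq r] {n : ℕ}

lemma cqState_apply (p : Fin n → ℝ) (σ : Fin n → Matrix r r ℂ) (s t : Fin n × r) :
    cqState p σ s t = if s.1 = t.1 then (p s.1 : ℂ) * σ s.1 s.2 t.2 else 0 := by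
  simp only [cqState, Matrix.sum_apply, Matrix.smul_apply, Matrix.kroneckerMap_apply,
    Matrix.single_apply, smul_eq_mul]
  rw [Finset.sum_eq_single s.1]
  · simp
  · intro x _ hx
    simp [hx]
  · simp

lemma cqState_eq_blockDiagonal (p : Fin n → ℝ) (σ : Fin n → Matrix r r ℂ) :
    cqState p σ = (Matrix.blockDiagonal fun x => (p x : ℂ) • σ x).submatrix
      (Equiv.prodComm _ _) (Equiv.prodComm _ _) := by
  ext s t
  simp [cqState_apply, Matrix.blockDiagonal_apply]

lemma posSemidef_cqState {p : Fin n → ℝ} (hp : ∀ x, 0 ≤ p x) {σ : Fin n → Matrix r r ℂ}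
    (hσ : ∀ x, (σ x).PosSemidef) : (cqState p σ).PosSemidef := by
  refine Matrix.posSemidef_sum _ fun x _ => Matrix.PosSemidef.smul ?_ (Complex.zero_le_real.2 (hp x))
  refine Matrix.PosSemidef.kronecker ?_ (hσ x)
  rw [← Matrix.diagonal_single]
  refine Matrix.PosSemidef.diagonal fun y => ?_
  by_cases h : y = x
  · subst h
    simp
  · simp [h]

/-- The entropy of a classical-quantum state is that of the label plus the average entropy. -/
lemma entropy_cqState (p : Fin n → ℝ) {σ : Fin n → Matrix r r ℂ} (hσ : ∀ x, IsState (σ x)) :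
    entropy (cqState p σ) = ∑ x, entropyTerm (p x) + ∑ x, p x * entropy (σ x) := by
  choose U hU d hd using fun x => exists_eq_conjDiag (hσ x).posSemidef.isHermitian
  have hd1 : ∀ x, ∑ i, d x i = 1 := fun x => by
    have := trace_conjDiag (hU x) (d x)
    rw [← hd x, (hσ x).trace_eq_one] at this
    exact_mod_cast this.symm
  have hB : Matrix.blockDiagonal U ∈ Matrix.unitaryGroup (r × Fin n) ℂ := by
    rw [Matrix.mem_unitaryGroup_iff, Matrix.star_eq_conjTranspose,
      Matrix.blockDiagonal_conjTranspose, ← Matrix.blockDiagonal_mul]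
    simp only [fun x => self_mul_conjTranspose_of_mem (hU x)]
    exact Matrix.blockDiagonal_one
  have hblock : (Matrix.blockDiagonal fun x => (p x : ℂ) • σ x)
      = conjDiag (Matrix.blockDiagonal U) fun q => p q.2 * d q.2 q.1 := by
    have hdiag : (Matrix.diagonal fun q : r × Fin n => ((p q.2 * d q.2 q.1 : ℝ) : ℂ))
        = Matrix.blockDiagonal fun x => Matrix.diagonal fun i => ((p x * d x i : ℝ) : ℂ) :=
      (Matrix.blockDiagonal_diagonal fun x i => ((p x * d x i : ℝ) : ℂ)).symm
    rw [conjDiag, hdiag, Matrix.blockDiagonal_conjTranspose, ← Matrix.blockDiagonal_mul,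
      ← Matrix.blockDiagonal_mul]
    congr 1
    funext x
    have hs : (Matrix.diagonal fun i => ((p x * d x i : ℝ) : ℂ))
        = (p x : ℂ) • Matrix.diagonal fun i => (d x i : ℂ) := by
      rw [← Matrix.diagonal_smul]
      congr 1
      ext i
      simp
    rw [hs, Matrix.mul_smul, Matrix.smul_mul, hd x, conjDiag]
  have hherm : (Matrix.blockDiagonal fun x => (p x : ℂ) • σ x).IsHermitian := by
    rw [Matrix.IsHermitian, Matrix.blockDiagonal_conjTranspose]
    congr 1
    funext x
    rw [Matrix.conjTranspose_smul, (hσ x).posSemidef.isHermitian]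
    simp
  rw [cqState_eq_blockDiagonal, entropy_submatrix_equiv hherm, hblock, entropy_conjDiag hB,
    Fintype.sum_prod_type_right]
  simp only [entropyTerm_mul, Finset.sum_add_distrib, ← Finset.sum_mul, ← Finset.mul_sum, hd1,
    one_mul]
  congr 1
  refine Finset.sum_congr rfl fun x _ => ?_
  rw [hd x, entropy_conjDiag (hU x)]

lemma marginalFst_cqState (p : Fin n → ℝ) {σ : Fin n → Matrix r r ℂ}
    (hσ : ∀ x, (σ x).trace = 1) : marginalFst (cqState p σ) = conjDiag 1 p := by
  ext x y
  rw [conjDiag_one]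
  simp only [marginalFst, Matrix.of_apply, cqState_apply, Matrix.diagonal_apply]
  split_ifs with h
  · subst h
    rw [← Finset.mul_sum]
    have := hσ x
    rw [Matrix.trace] at this
    simp only [Matrix.diag_apply] at this
    rw [this, mul_one]
  · simp

lemma marginalSnd_cqState (p : Fin n → ℝ) (σ : Fin n → Matrix r r ℂ) :
    marginalSnd (cqState p σ) = ∑ x, (p x : ℂ) • σ x := by
  ext i j
  simp [marginalSnd, cqState_apply, Matrix.sum_apply]

/-- The mutual information of a classical-quantum state is the Holevo quantity. -/
lemma mutualInfo_cqState {p : Fin n → ℝ} (hp : ∀ x, 0 ≤ p x) {σ : Fin n → Matrix r r ℂ}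
    (hσ : ∀ x, IsState (σ x)) :
    mutualInfo (cqState p σ)
      = entropy (∑ x, (p x : ℂ) • σ x) - ∑ x, p x * entropy (σ x) := by
  rw [mutualInfo_eq (posSemidef_cqState hp fun x => (hσ x).posSemidef),
    marginalFst_cqState p fun x => (hσ x).trace_eq_one, marginalSnd_cqState, entropy_cqState p hσ,
    entropy_conjDiag (one_mem _)]
  ring

lemma marginalFst_regroup_cqState (p : Fin n → ℝ) (σ : Fin n → Matrix (b × r) (b × r) ℂ) :
    marginalFst (regroup (cqState p σ)) = cqState p fun x => marginalSnd (σ x) := by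
  ext s t
  simp only [marginalFst, marginalSnd, regroup, Matrix.of_apply, Matrix.submatrix_apply,
    cqState_apply]
  split_ifs with h
  · rw [Finset.mul_sum]
  · simp

lemma marginalSnd_regroup_cqState (p : Fin n → ℝ) (σ : Fin n → Matrix (b × r) (b × r) ℂ) :
    marginalSnd (regroup (cqState p σ)) = marginalFst (∑ x, (p x : ℂ) • σ x) := by
  ext s t
  simp [marginalFst, marginalSnd, regroup, cqState_apply, Matrix.sum_apply, Fintype.sum_prod_type]
  rw [Finset.sum_comm]

/-- If all letters leave the same marginal `τ` on the assisting system, then regrouping a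
classical-quantum state replaces the entropy of the average output by the sum of those of its
marginals. -/
lemma mutualInfo_regroup_cqState {p : Fin n → ℝ} (hp : ∀ x, 0 ≤ p x) (hp1 : ∑ x, p x = 1)
    {σ : Fin n → Matrix (b × r) (b × r) ℂ} (hσ : ∀ x, IsState (σ x)) {τ : Matrix r r ℂ}
    (hτ : IsState τ) (hmarg : ∀ x, marginalSnd (σ x) = τ) :
    mutualInfo (regroup (cqState p σ))
      = entropy (marginalFst (∑ x, (p x : ℂ) • σ x)) + entropy τ
        - ∑ x, p x * entropy (σ x) := by
  have hpos := posSemidef_cqState hp fun x => (hσ x).posSemidef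
  let f : (Fin n × r) × b ≃ Fin n × (b × r) :=
    { toFun := fun q => (q.1.1, (q.2, q.1.2))
      invFun := fun q => ((q.1, q.2.2), q.2.1)
      left_inv := fun _ => rfl
      right_inv := fun _ => rfl }
  have hreg : regroup (cqState p σ) = (cqState p σ).submatrix f f := rfl
  have hent : entropy (regroup (cqState p σ)) = entropy (cqState p σ) := by
    rw [hreg, entropy_submatrix_equiv hpos.isHermitian]
  rw [mutualInfo_eq (hreg ▸ hpos.submatrix f), hent, marginalFst_regroup_cqState,
    marginalSnd_regroup_cqState, entropy_cqState p hσ]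
  simp only [hmarg]
  rw [entropy_cqState p fun _ => hτ, ← Finset.sum_mul, hp1]
  ring

end ClassicalQuantum

/-! ### Channels acting on one factor -/

section Channels

variable {a b c r : Type*} [Fintype a] [DecidableEq a] [Fintype b] [DecidableEq b]
  [Fintype c] [DecidableEq c] [Fintype r] [DecidableEq r]

lemma tensorId_apply (N : Matrix a a ℂ →ₗ[ℂ] Matrix b b ℂ) (M : Matrix (a × r) (a × r) ℂ)
    (p q : b × r) :
    tensorId N r M p q = N (Matrix.of fun i j => M (i, p.2) (j, q.2)) p.1 q.1 := rfl

lemma tensorId_comp (N : Matrix b b ℂ →ₗ[ℂ] Matrix c c ℂ) (E : Matrix a a ℂ →ₗ[ℂ] Matrix b b ℂ)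
    (M : Matrix (a × r) (a × r) ℂ) :
    tensorId N r (tensorId E r M) = tensorId (N ∘ₗ E) r M := rfl

lemma tensorId_sum_smul {n : ℕ} (p : Fin n → ℂ) (N : Fin n → Matrix a a ℂ →ₗ[ℂ] Matrix b b ℂ)
    (M : Matrix (a × r) (a × r) ℂ) :
    tensorId (∑ x, p x • N x) r M = ∑ x, p x • tensorId (N x) r M := by
  ext s t
  simp [tensorId_apply, Matrix.sum_apply]

lemma marginalFst_tensorId (N : Matrix a a ℂ →ₗ[ℂ] Matrix b b ℂ)
    (M : Matrix (a × r) (a × r) ℂ) : marginalFst (tensorId N r M) = N (marginalFst M) := by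
  have : marginalFst M = ∑ k, Matrix.of fun i j => M (i, k) (j, k) := by
    ext i j
    simp [marginalFst, Matrix.sum_apply]
  rw [this, map_sum]
  ext i j
  simp [marginalFst, Matrix.sum_apply, tensorId_apply]

lemma IsChannel.marginalSnd_tensorId {N : Matrix a a ℂ →ₗ[ℂ] Matrix b b ℂ} (hN : IsChannel N)
    (M : Matrix (a × r) (a × r) ℂ) : marginalSnd (tensorId N r M) = marginalSnd M := by
  ext k l
  exact hN.tracePreserving (Matrix.of fun i j => M (i, k) (j, l))

lemma IsChannel.posSemidef_tensorId {N : Matrix a a ℂ →ₗ[ℂ] Matrix b b ℂ} (hN : IsChannel N)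
    {M : Matrix (a × r) (a × r) ℂ} (hM : M.PosSemidef) : (tensorId N r M).PosSemidef := by
  let f := Fintype.equivFin r
  have h := hN.completelyPositive _ _
    (hM.submatrix fun q : a × Fin (Fintype.card r) => (q.1, f.symm q.2))
  have h2 := h.submatrix fun q : b × r => (q.1, f q.2)
  convert h2 using 1
  ext s t
  simp [tensorId_apply]

lemma IsChannel.isState_tensorId {N : Matrix a a ℂ →ₗ[ℂ] Matrix b b ℂ} (hN : IsChannel N)
    {M : Matrix (a × r) (a × r) ℂ} (hM : IsState M) : IsState (tensorId N r M) where
  posSemidef := hN.posSemidef_tensorId hM.posSemidef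
  trace_eq_one := by
    rw [← trace_marginalSnd, hN.marginalSnd_tensorId, trace_marginalSnd, hM.trace_eq_one]

lemma isState_marginalFst {M : Matrix (a × r) (a × r) ℂ} (hM : IsState M) :
    IsState (marginalFst M) :=
  ⟨posSemidef_marginalFst hM.posSemidef, by rw [trace_marginalFst, hM.trace_eq_one]⟩

lemma isState_marginalSnd {M : Matrix (a × r) (a × r) ℂ} (hM : IsState M) :
    IsState (marginalSnd M) :=
  ⟨posSemidef_marginalSnd hM.posSemidef, by rw [trace_marginalSnd, hM.trace_eq_one]⟩

/-- A channel maps states to states: the case of a trivial second factor. -/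
lemma IsChannel.isState_apply {N : Matrix a a ℂ →ₗ[ℂ] Matrix b b ℂ} (hN : IsChannel N)
    {σ : Matrix a a ℂ} (hσ : IsState σ) : IsState (N σ) where
  posSemidef :=
    (hN.posSemidef_tensorId (r := Unit) (hσ.posSemidef.submatrix Prod.fst)).submatrix
      fun i => (i, ())
  trace_eq_one := by rw [hN.tracePreserving, hσ.trace_eq_one]

lemma IsChannel.comp {N : Matrix b b ℂ →ₗ[ℂ] Matrix c c ℂ} (hN : IsChannel N)
    {E : Matrix a a ℂ →ₗ[ℂ] Matrix b b ℂ} (hE : IsChannel E) : IsChannel (N ∘ₗ E) where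
  completelyPositive n M hM := hN.completelyPositive n _ (hE.completelyPositive n M hM)
  tracePreserving M := (hN.tracePreserving _).trans (hE.tracePreserving M)

lemma isState_sum_smul {n : ℕ} {p : Fin n → ℝ} (hp : ∀ x, 0 ≤ p x) (hp1 : ∑ x, p x = 1)
    {σ : Fin n → Matrix a a ℂ} (hσ : ∀ x, IsState (σ x)) :
    IsState (∑ x, (p x : ℂ) • σ x) where
  posSemidef := Matrix.posSemidef_sum _ fun x _ =>
    (hσ x).posSemidef.smul (Complex.zero_le_real.2 (hp x))
  trace_eq_one := by
    rw [Matrix.trace_sum]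
    simp only [Matrix.trace_smul, fun x => (hσ x).trace_eq_one, smul_eq_mul, mul_one]
    exact_mod_cast hp1

/-- Conjugation `M ↦ U M U†`. -/
def conjMap (U : Matrix a a ℂ) : Matrix a a ℂ →ₗ[ℂ] Matrix a a ℂ where
  toFun M := U * M * Uᴴ
  map_add' M M' := by rw [Matrix.mul_add, Matrix.add_mul]
  map_smul' c M := by simp

lemma conjMap_apply (U M : Matrix a a ℂ) : conjMap U M = U * M * Uᴴ := rfl

lemma tensorId_conjMap (U : Matrix a a ℂ) (M : Matrix (a × r) (a × r) ℂ) :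
    tensorId (conjMap U) r M = (U ⊗ₖ (1 : Matrix r r ℂ)) * M * (U ⊗ₖ (1 : Matrix r r ℂ))ᴴ := by
  ext s t
  simp [tensorId_apply, conjMap_apply, Matrix.mul_apply, Fintype.sum_prod_type,
    Matrix.one_apply, Finset.sum_mul, apply_ite]

lemma isChannel_conjMap {U : Matrix a a ℂ} (hU : U ∈ Matrix.unitaryGroup a ℂ) :
    IsChannel (conjMap U) where
  completelyPositive n M hM := by
    rw [tensorId_conjMap]
    exact hM.mul_mul_conjTranspose_same _
  tracePreserving M := by
    rw [conjMap_apply, Matrix.trace_mul_cycle, conjTranspose_mul_self_of_mem hU, one_mul]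

/-- The channel `M ↦ tr(M) σ`. -/
def replaceMap (a : Type*) [Fintype a] (σ : Matrix b b ℂ) :
    Matrix a a ℂ →ₗ[ℂ] Matrix b b ℂ :=
  (Matrix.traceLinearMap a ℂ ℂ).smulRight σ

lemma replaceMap_apply (σ : Matrix b b ℂ) (M : Matrix a a ℂ) :
    replaceMap a σ M = M.trace • σ := rfl

lemma tensorId_replaceMap (σ : Matrix b b ℂ) (M : Matrix (a × r) (a × r) ℂ) :
    tensorId (replaceMap a σ) r M = σ ⊗ₖ marginalSnd M := by
  ext s t
  simp [tensorId_apply, replaceMap_apply, marginalSnd, Matrix.trace, mul_comm]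

lemma isChannel_replaceMap {σ : Matrix b b ℂ} (hσ : IsState σ) :
    IsChannel (replaceMap a σ) where
  completelyPositive n M hM := by
    rw [tensorId_replaceMap]
    exact hσ.posSemidef.kronecker (posSemidef_marginalSnd hM)
  tracePreserving M := by simp [replaceMap_apply, Matrix.trace_smul, hσ.trace_eq_one]

lemma isState_maxMixed [Nonempty a] : IsState (maxMixed a) where
  posSemidef := Matrix.PosSemidef.one.smul (by positivity)
  trace_eq_one := by
    rw [maxMixed, Matrix.trace_smul, Matrix.trace_one, smul_eq_mul]
    exact inv_mul_cancel₀ (by simp)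

end Channels

/-! ### Continuity of the entropy and attainment of the minimal output entropy -/

section Compactness

variable {a b e r : Type*} [Fintype a] [DecidableEq a] [Fintype b] [DecidableEq b]
  [Fintype e] [DecidableEq e] [Fintype r] [DecidableEq r]

lemma isClosed_posSemidef : IsClosed {M : Matrix a a ℂ | M.PosSemidef} := by
  have : {M : Matrix a a ℂ | M.PosSemidef}
      = {M | Mᴴ = M} ∩ ⋂ x : a → ℂ, {M | 0 ≤ star x ⬝ᵥ (M *ᵥ x)} := by
    ext M
    simp [Matrix.posSemidef_iff_dotProduct_mulVec, Matrix.IsHermitian]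
  rw [this]
  refine (isClosed_eq (by fun_prop) (by fun_prop)).inter (isClosed_iInter fun x => ?_)
  exact isClosed_le continuous_const
    (continuous_const.dotProduct (continuous_id.matrix_mulVec continuous_const))

lemma norm_apply_le_of_posSemidef {M : Matrix a a ℂ} (hM : M.PosSemidef) (i j : a) :
    ‖M i j‖ ≤ M.trace.re := by
  obtain ⟨U, hU, d, hd⟩ := exists_eq_conjDiag hM.isHermitian
  have hd0 := nonneg_of_conjDiag hU hM hd
  rw [hd, trace_conjDiag hU, conjDiag, Matrix.mul_apply, Complex.re_sum]
  refine (norm_sum_le _ _).trans (Finset.sum_le_sum fun k _ => ?_)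
  rw [Matrix.mul_diagonal, norm_mul, norm_mul, Matrix.conjTranspose_apply, norm_star,
    Complex.norm_real, Real.norm_of_nonneg (hd0 k), Complex.ofReal_re]
  have h1 := entry_norm_bound_of_unitary hU i k
  have h2 := entry_norm_bound_of_unitary hU j k
  calc ‖U i k‖ * d k * ‖U j k‖ ≤ 1 * d k * 1 := by
        have := hd0 k
        gcongr
    _ = d k := by ring

lemma entropy_eq_trace_cfc {ρ : Matrix a a ℂ} (hρ : ρ.IsHermitian) :
    entropy ρ = (cfc entropyTerm ρ).trace.re := by
  obtain ⟨U, hU, d, rfl⟩ := exists_eq_conjDiag hρ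
  rw [entropy_conjDiag hU, cfc_conjDiag hU, trace_conjDiag hU]
  simp

lemma spectrum_subset_of_isState {ρ : Matrix a a ℂ} (hρ : IsState ρ) :
    spectrum ℝ ρ ⊆ Set.Icc 0 1 := by
  have hh := hρ.posSemidef.isHermitian
  rw [hh.spectrum_real_eq_range_eigenvalues]
  rintro _ ⟨i, rfl⟩
  have h0 := hρ.posSemidef.eigenvalues_nonneg
  refine ⟨h0 i, ?_⟩
  have h1 := hh.trace_eq_sum_eigenvalues
  rw [hρ.trace_eq_one] at h1
  have h2 : ∑ i, hh.eigenvalues i = 1 := by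
    apply Complex.ofReal_injective
    rw [Complex.ofReal_sum, Complex.ofReal_one, h1]
    rfl
  rw [← h2]
  exact Finset.single_le_sum (fun j _ => h0 j) (Finset.mem_univ i)

open scoped Matrix.Norms.L2Operator in
lemma continuousOn_entropy : ContinuousOn entropy {ρ : Matrix a a ℂ | IsState ρ} := by
  have h : ContinuousOn (fun ρ : Matrix a a ℂ => cfc entropyTerm ρ) {ρ | IsState ρ} :=
    ContinuousOn.cfc' (isCompact_Icc (a := (0 : ℝ)) (b := 1)) entropyTerm continuousOn_id
      (fun ρ hρ => spectrum_subset_of_isState hρ) (fun ρ hρ => hρ.posSemidef.isHermitian)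
      (Real.continuous_negMulLog.div_const _).continuousOn
  have h2 : ContinuousOn (fun ρ : Matrix a a ℂ => (cfc entropyTerm ρ).trace.re) {ρ | IsState ρ} :=
    (Complex.continuous_re.comp (continuous_id.matrix_trace)).comp_continuousOn h
  exact h2.congr fun ρ hρ => entropy_eq_trace_cfc hρ.posSemidef.isHermitian

/-- The linear map whose value at the matrix unit `|i⟩⟨j|` is `C i j`. -/
def ofUnitValues (C : e → e → Matrix a a ℂ) : Matrix e e ℂ →ₗ[ℂ] Matrix a a ℂ where
  toFun M := ∑ i, ∑ j, M i j • C i j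
  map_add' M M' := by simp [add_smul, Finset.sum_add_distrib]
  map_smul' c M := by simp [mul_smul, Finset.smul_sum]

lemma ofUnitValues_single (C : e → e → Matrix a a ℂ) (i j : e) :
    ofUnitValues C (Matrix.single i j 1) = C i j := by
  change ∑ k, ∑ l, Matrix.single i j (1 : ℂ) k l • C k l = C i j
  rw [Finset.sum_eq_single i, Finset.sum_eq_single j]
  · simp
  · intro l _ hl
    simp [hl.symm]
  · simp
  · intro k _ hk
    simp [hk.symm]
  · simp

lemma exists_eq_ofUnitValues (E : Matrix e e ℂ →ₗ[ℂ] Matrix a a ℂ) :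
    E = ofUnitValues fun i j => E (Matrix.single i j 1) := by
  refine LinearMap.ext fun M => ?_
  conv_lhs => rw [Matrix.matrix_eq_sum_single M]
  simp only [map_sum]
  refine Finset.sum_congr rfl fun i _ => Finset.sum_congr rfl fun j _ => ?_
  rw [← map_smul]
  simp

lemma continuous_ofUnitValues (M : Matrix e e ℂ) :
    Continuous fun C : e → e → Matrix a a ℂ => ofUnitValues C M := by
  change Continuous fun C : e → e → Matrix a a ℂ => ∑ i, ∑ j, M i j • C i j
  fun_prop

lemma continuous_tensorId_ofUnitValues (M : Matrix (e × r) (e × r) ℂ) :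
    Continuous fun C : e → e → Matrix a a ℂ => tensorId (ofUnitValues C) r M :=
  continuous_matrix fun p q =>
    (continuous_ofUnitValues (Matrix.of fun i j => M (i, p.2) (j, q.2))).matrix_elem p.1 q.1

/-- Channels form a compact set: the conditions are closed, and the entries of the Choi matrix are
bounded by its trace. -/
lemma isCompact_setOf_isChannel :
    IsCompact {C : e → e → Matrix a a ℂ | IsChannel (ofUnitValues C)} := by
  have hclosed : IsClosed {C : e → e → Matrix a a ℂ | IsChannel (ofUnitValues C)} := by
    have : {C : e → e → Matrix a a ℂ | IsChannel (ofUnitValues C)}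
        = (⋂ (n : ℕ) (M : Matrix (e × Fin n) (e × Fin n) ℂ) (_ : M.PosSemidef),
            {C | (tensorId (ofUnitValues C) (Fin n) M).PosSemidef})
          ∩ ⋂ M : Matrix e e ℂ, {C | (ofUnitValues C M).trace = M.trace} := by
      ext C
      simp only [Set.mem_inter_iff, Set.mem_iInter, Set.mem_ofPred_eq]
      exact ⟨fun h => ⟨h.1, h.2⟩, fun h => ⟨h.1, h.2⟩⟩
    rw [this]
    refine IsClosed.inter ?_ ?_
    · exact isClosed_iInter fun n => isClosed_iInter fun M => isClosed_iInter fun _ =>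
        isClosed_posSemidef.preimage (continuous_tensorId_ofUnitValues M)
    · exact isClosed_iInter fun M =>
        isClosed_eq (continuous_ofUnitValues M).matrix_trace continuous_const
  have hbox : IsCompact {C : e → e → Matrix a a ℂ |
      ∀ i j k l, C i j k l ∈ Metric.closedBall (0 : ℂ) (Fintype.card e)} := by
    have h := isCompact_univ_pi fun _ : e => isCompact_univ_pi fun _ : e =>
      isCompact_univ_pi fun _ : a => isCompact_univ_pi fun _ : a =>
        isCompact_closedBall (0 : ℂ) (Fintype.card e)
    have heq : {C : e → e → Matrix a a ℂ |
        ∀ i j k l, C i j k l ∈ Metric.closedBall (0 : ℂ) (Fintype.card e)}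
        = Set.univ.pi fun _ : e => Set.univ.pi fun _ : e => Set.univ.pi fun _ : a =>
          Set.univ.pi fun _ : a => Metric.closedBall (0 : ℂ) (Fintype.card e) := by
      ext C
      exact ⟨fun h i _ j _ k _ l _ => h i j k l,
        fun h i j k l => h i trivial j trivial k trivial l trivial⟩
    rw [heq]
    exact h
  refine hbox.of_isClosed_subset hclosed fun C hC i j k l => ?_
  have hC : IsChannel (ofUnitValues C) := hC
  let v : e × e → ℂ := fun q => if q.1 = q.2 then 1 else 0
  have hpos := hC.posSemidef_tensorId (r := e) (Matrix.posSemidef_vecMulVec_self_star v)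
  have htr : (tensorId (ofUnitValues C) e (Matrix.vecMulVec v (star v))).trace
      = Fintype.card e := by
    rw [← trace_marginalSnd, hC.marginalSnd_tensorId, trace_marginalSnd]
    simp [Matrix.trace, Matrix.vecMulVec_apply, v, Fintype.sum_prod_type]
  have hb := norm_apply_le_of_posSemidef hpos (k, i) (l, j)
  have hsingle : (Matrix.of fun s t => Matrix.vecMulVec v (star v) (s, i) (t, j))
      = Matrix.single i j (1 : ℂ) := by
    ext s t
    simp only [Matrix.of_apply, Matrix.vecMulVec_apply, Pi.star_apply, v, Matrix.single_apply,
      @eq_comm _ i s, @eq_comm _ j t]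
    by_cases h1 : s = i <;> by_cases h2 : t = j <;> simp [h1, h2]
  rw [htr, tensorId_apply, hsingle, ofUnitValues_single] at hb
  simpa using hb

lemma exists_isLeast_outputEntropies [Nonempty a] {ρ : Matrix (e × r) (e × r) ℂ}
    (hρ : IsState ρ) {N : Matrix a a ℂ →ₗ[ℂ] Matrix b b ℂ} (hN : IsChannel N) :
    ∃ E : Matrix e e ℂ →ₗ[ℂ] Matrix a a ℂ, IsChannel E ∧
      IsLeast (outputEntropies ρ N) (entropy (tensorId N r (tensorId E r ρ))) := by
  have hne : {C : e → e → Matrix a a ℂ | IsChannel (ofUnitValues C)}.Nonempty := by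
    refine ⟨fun i j => replaceMap e (maxMixed a) (Matrix.single i j 1), ?_⟩
    rw [Set.mem_ofPred_eq, ← exists_eq_ofUnitValues]
    exact isChannel_replaceMap isState_maxMixed
  have hlin : Continuous fun M : Matrix (a × r) (a × r) ℂ => tensorId N r M :=
    LinearMap.continuous_of_finiteDimensional _
  obtain ⟨C, hC, hmin⟩ := isCompact_setOf_isChannel.exists_isMinOn hne
    (continuousOn_entropy.comp
      (hlin.comp (continuous_tensorId_ofUnitValues (a := a) ρ)).continuousOn
      fun C hC => hN.isState_tensorId (IsChannel.isState_tensorId hC hρ))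
  refine ⟨ofUnitValues C, hC, ⟨_, hC, rfl⟩, ?_⟩
  rintro _ ⟨E, hE, rfl⟩
  rw [exists_eq_ofUnitValues E] at hE ⊢
  exact hmin hE

end Compactness

/-! ### Finite twirls for irreducible representations of compact groups -/

section Twirl

/-- Carathéodory's theorem, with the points indexed by an initial segment of `ℕ`. -/
lemma exists_fin_of_mem_convexHull {V : Type*} [AddCommGroup V] [Module ℝ V]
    [FiniteDimensional ℝ V] {s : Set V} {v : V} (hv : v ∈ convexHull ℝ s) :
    ∃ n ≤ Module.finrank ℝ V + 1, ∃ w ∈ stdSimplex ℝ (Fin n), ∃ z : Fin n → V,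
      (∀ i, z i ∈ s) ∧ ∑ i, w i • z i = v := by
  obtain ⟨ι, _, z, w, hz, hind, hw, hw1, rfl⟩ := eq_pos_convex_span_of_mem_convexHull hv
  let f := (Fintype.equivFin ι).symm
  refine ⟨Fintype.card ι, ?_, w ∘ f, ⟨fun i => (hw _).le, ?_⟩, z ∘ f,
    fun i => hz ⟨_, rfl⟩, ?_⟩
  · exact hind.card_le_finrank_succ.trans (Nat.succ_le_succ (Submodule.finrank_le _))
  · exact (Equiv.sum_comp f w).trans hw1
  · exact Equiv.sum_comp f fun i => w i • z i

lemma isCompact_convexHull_of_isCompact {V : Type*} [AddCommGroup V] [Module ℝ V]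
    [FiniteDimensional ℝ V] [TopologicalSpace V] [ContinuousAdd V] [ContinuousSMul ℝ V]
    {s : Set V} (hs : IsCompact s) : IsCompact (convexHull ℝ s) := by
  have heq : convexHull ℝ s = ⋃ n ∈ Set.Iic (Module.finrank ℝ V + 1),
      (fun q : (Fin n → ℝ) × (Fin n → V) => ∑ i, q.1 i • q.2 i) ''
        (stdSimplex ℝ (Fin n) ×ˢ Set.univ.pi fun _ => s) := by
    ext v
    simp only [Set.mem_iUnion, Set.mem_image]
    constructor
    · intro hv
      obtain ⟨n, hn, w, hw, z, hz, h⟩ := exists_fin_of_mem_convexHull hv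
      exact ⟨n, hn, (w, z), ⟨hw, fun i _ => hz i⟩, h⟩
    · rintro ⟨n, -, ⟨w, z⟩, ⟨hw, hz⟩, rfl⟩
      exact (convex_convexHull ℝ s).sum_mem (fun i _ => hw.1 i) hw.2
        fun i _ => subset_convexHull ℝ s (hz i trivial)
  rw [heq]
  refine (Set.finite_Iic _).isCompact_biUnion fun n _ => ?_
  exact ((isCompact_stdSimplex ℝ _).prod (isCompact_univ_pi fun _ => hs)).image (by fun_prop)

variable {a : Type*} [Fintype a] [DecidableEq a]

lemma sum_normSq_unitary_conj {U : Matrix a a ℂ} (hU : U ∈ Matrix.unitaryGroup a ℂ)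
    (M : Matrix a a ℂ) : ∑ k, ∑ l, Complex.normSq ((U * M * Uᴴ) k l)
      = ∑ k, ∑ l, Complex.normSq (M k l) := by
  have h : ∀ A : Matrix a a ℂ,
      ((∑ k, ∑ l, Complex.normSq (A k l) : ℝ) : ℂ) = (A * Aᴴ).trace := fun A => by
    simp [Matrix.trace, Matrix.mul_apply, Complex.mul_conj]
  apply Complex.ofReal_injective
  rw [h, h]
  have : U * M * Uᴴ * (U * M * Uᴴ)ᴴ = U * (M * (Uᴴ * U) * Mᴴ) * Uᴴ := by
    simp [Matrix.mul_assoc]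
  rw [this, conjTranspose_mul_self_of_mem hU, mul_one, Matrix.trace_mul_cycle,
    conjTranspose_mul_self_of_mem hU, one_mul]

/-- The element of least Hilbert–Schmidt norm in a compact convex set of tuples of operators is
unique, hence fixed by any unitary conjugation that preserves the set. -/
lemma exists_fixed_of_isCompact_convex {κ : Type*} [Fintype κ] {K : Set (κ → Matrix a a ℂ)}
    (hK : IsCompact K) (hconv : Convex ℝ K) (hne : K.Nonempty) :
    ∃ P ∈ K, ∀ U ∈ Matrix.unitaryGroup a ℂ, (∀ Q ∈ K, (fun z => U * Q z * Uᴴ) ∈ K) →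
      ∀ z, U * P z * Uᴴ = P z := by
  let F : (κ → Matrix a a ℂ) → ℝ := fun Q => ∑ z, ∑ k, ∑ l, Complex.normSq (Q z k l)
  have hF : Continuous F := by
    have h : ∀ z k l, Continuous fun Q : κ → Matrix a a ℂ => Complex.normSq (Q z k l) :=
      fun z k l => Complex.continuous_normSq.comp ((continuous_apply z).matrix_elem k l)
    exact continuous_finsetSum _ fun z _ => continuous_finsetSum _ fun k _ =>
      continuous_finsetSum _ fun l _ => h z k l
  obtain ⟨P, hP, hmin⟩ := hK.exists_isMinOn hne hF.continuousOn
  refine ⟨P, hP, fun U hU hUK z => ?_⟩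
  set Q : κ → Matrix a a ℂ := fun z => U * P z * Uᴴ with hQ
  have hFQ : F Q = F P := Finset.sum_congr rfl fun z _ => sum_normSq_unitary_conj hU (P z)
  -- The parallelogram identity at the midpoint forces `Q = P`.
  have hmid := hconv hP (hUK P hP) (a := 1 / 2) (b := 1 / 2) (by norm_num) (by norm_num)
    (by norm_num)
  have hpar : F ((1 / 2 : ℝ) • P + (1 / 2 : ℝ) • Q)
      = F P / 2 + F Q / 2 - F (fun z => Q z - P z) / 4 := by
    simp only [F, Finset.sum_div, ← Finset.sum_add_distrib, ← Finset.sum_sub_distrib]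
    refine Finset.sum_congr rfl fun z _ => Finset.sum_congr rfl fun k _ =>
      Finset.sum_congr rfl fun l _ => ?_
    simp only [Pi.add_apply, Pi.smul_apply, Matrix.add_apply, Matrix.smul_apply, Matrix.sub_apply,
      Complex.normSq_apply, Complex.add_re, Complex.add_im, Complex.smul_re, Complex.smul_im,
      Complex.sub_re, Complex.sub_im, smul_eq_mul]
    ring
  have hle : F P ≤ F ((1 / 2 : ℝ) • P + (1 / 2 : ℝ) • Q) := hmin hmid
  have h0 : F (fun z => Q z - P z) ≤ 0 := by
    rw [hpar, hFQ] at hle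
    linarith
  have hnn : ∀ z k l, 0 ≤ Complex.normSq ((Q z - P z) k l) := fun z k l => Complex.normSq_nonneg _
  ext k l
  have h1 : Complex.normSq ((Q z - P z) k l) ≤ F fun z => Q z - P z :=
    (Finset.single_le_sum (f := fun l => Complex.normSq ((Q z - P z) k l))
      (fun l _ => hnn z k l) (Finset.mem_univ l)).trans <|
    (Finset.single_le_sum (f := fun k => ∑ l, Complex.normSq ((Q z - P z) k l))
      (fun k _ => Finset.sum_nonneg fun l _ => hnn z k l) (Finset.mem_univ k)).trans <|
    Finset.single_le_sum (f := fun z => ∑ k, ∑ l, Complex.normSq ((Q z - P z) k l))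
      (fun z _ => Finset.sum_nonneg fun k _ => Finset.sum_nonneg fun l _ => hnn z k l)
      (Finset.mem_univ z)
  have h2 := Complex.normSq_eq_zero.1 (le_antisymm (h1.trans h0) (hnn z k l))
  exact sub_eq_zero.1 h2

/-- Schur's lemma. -/
lemma IsIrreducibleRep.exists_eq_smul_one {G : Type*} {f : G → Matrix.unitaryGroup a ℂ}
    (hf : IsIrreducibleRep f) {P : Matrix a a ℂ}
    (hP : ∀ g, (f g : Matrix a a ℂ) * P = P * (f g : Matrix a a ℂ)) :
    ∃ c : ℂ, P = c • (1 : Matrix a a ℂ) := by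
  have := hf.nonempty
  obtain ⟨c, hc⟩ := Module.End.exists_eigenvalue (Matrix.toLin' P)
  refine ⟨c, ?_⟩
  rcases hf.eq_bot_or_eq_top (Module.End.eigenspace (Matrix.toLin' P) c) (fun g v hv => by
    rw [Module.End.mem_eigenspace_iff, Matrix.toLin'_apply] at hv ⊢
    rw [Matrix.mulVec_mulVec, ← hP, ← Matrix.mulVec_mulVec, hv, Matrix.mulVec_smul]) with h | h
  · exact absurd h hc
  · refine Matrix.toLin'.injective (LinearMap.ext fun v => ?_)
    have hv : v ∈ Module.End.eigenspace (Matrix.toLin' P) c := h ▸ Submodule.mem_top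
    rw [Module.End.mem_eigenspace_iff] at hv
    rw [hv]
    simp

/-- Some finite average of the conjugations by an irreducible projective representation of a
compact group is the completely depolarising channel. -/
lemma exists_twirl {G : Type*} [Group G] [TopologicalSpace G] [CompactSpace G]
    {f : G → Matrix.unitaryGroup a ℂ} (hf : IsProjectiveRep f) (hirr : IsIrreducibleRep f) :
    ∃ (n : ℕ) (p : Fin n → ℝ) (g : Fin n → G), (∀ x, 0 ≤ p x) ∧ ∑ x, p x = 1 ∧
      ∑ x, (p x : ℂ) • conjMap (f (g x) : Matrix a a ℂ) = replaceMap a (maxMixed a) := by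
  have := hirr.nonempty
  -- A conjugation is encoded by its values at the matrix units.
  let Φ : G → (a × a) → Matrix a a ℂ := fun g z => conjMap (f g : Matrix a a ℂ)
    (Matrix.single z.1 z.2 1)
  have hΦ : Continuous Φ := continuous_pi fun z => hf.continuous_conj _
  obtain ⟨P, hPK, hP⟩ := exists_fixed_of_isCompact_convex
    (isCompact_convexHull_of_isCompact (isCompact_range hΦ)) (convex_convexHull ℝ _)
    (Set.Nonempty.convexHull ⟨Φ 1, 1, rfl⟩)
  have hinv : ∀ g, ∀ Q ∈ convexHull ℝ (Set.range Φ),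
      (fun z => (f g : Matrix a a ℂ) * Q z * (f g : Matrix a a ℂ)ᴴ)
        ∈ convexHull ℝ (Set.range Φ) := by
    intro g Q hQ
    let L : ((a × a) → Matrix a a ℂ) →ₗ[ℝ] ((a × a) → Matrix a a ℂ) :=
      LinearMap.pi fun z => (conjMap (f g : Matrix a a ℂ)).restrictScalars ℝ ∘ₗ LinearMap.proj z
    have h1 : L Q ∈ L '' convexHull ℝ (Set.range Φ) := ⟨Q, hQ, rfl⟩
    rw [LinearMap.image_convexHull] at h1
    refine convexHull_mono ?_ h1
    rintro _ ⟨_, ⟨h, rfl⟩, rfl⟩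
    refine ⟨g * h, funext fun z => ?_⟩
    -- The phase of a projective representation cancels in the conjugation.
    obtain ⟨c, hc, hm⟩ := hf.mul_phase g h
    have hcc : c * star c = 1 := by
      rw [Complex.star_def, Complex.mul_conj, Complex.normSq_eq_norm_sq, hc]
      simp
    set M : Matrix a a ℂ := Matrix.single z.1 z.2 1
    change (f (g * h) : Matrix a a ℂ) * M * (f (g * h) : Matrix a a ℂ)ᴴ
      = (f g : Matrix a a ℂ) * ((f h : Matrix a a ℂ) * M * (f h : Matrix a a ℂ)ᴴ)
        * (f g : Matrix a a ℂ)ᴴ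
    have h2 : (f g : Matrix a a ℂ) * ((f h : Matrix a a ℂ) * M * (f h : Matrix a a ℂ)ᴴ)
        * (f g : Matrix a a ℂ)ᴴ = ((f g : Matrix a a ℂ) * (f h : Matrix a a ℂ)) * M
          * ((f g : Matrix a a ℂ) * (f h : Matrix a a ℂ))ᴴ := by
      simp only [Matrix.conjTranspose_mul, Matrix.mul_assoc]
    rw [h2, hm, Matrix.conjTranspose_smul, Matrix.mul_smul, Matrix.smul_mul, Matrix.smul_mul,
      smul_smul, mul_comm (star c), hcc, one_smul]
  obtain ⟨n, -, p, hp, z, hz, hsum⟩ := exists_fin_of_mem_convexHull hPK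
  choose g hg using hz
  refine ⟨n, p, g, hp.1, hp.2, ?_⟩
  have hval : ∀ i j, (∑ x, (p x : ℂ) • conjMap (f (g x) : Matrix a a ℂ)) (Matrix.single i j 1)
      = P (i, j) := by
    intro i j
    rw [← hsum, LinearMap.sum_apply, Finset.sum_apply]
    refine Finset.sum_congr rfl fun x _ => ?_
    rw [← hg x]
    rfl
  have htrace : ∀ M : Matrix a a ℂ,
      ((∑ x, (p x : ℂ) • conjMap (f (g x) : Matrix a a ℂ)) M).trace = M.trace := by
    intro M
    rw [LinearMap.sum_apply, Matrix.trace_sum]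
    simp only [LinearMap.smul_apply, Matrix.trace_smul, smul_eq_mul,
      fun x => (isChannel_conjMap (f (g x)).2).tracePreserving M, ← Finset.sum_mul]
    rw [← Complex.ofReal_sum, hp.2, Complex.ofReal_one, one_mul]
  rw [exists_eq_ofUnitValues (∑ x, (p x : ℂ) • conjMap (f (g x) : Matrix a a ℂ)),
    exists_eq_ofUnitValues (replaceMap a (maxMixed a))]
  congr 1
  funext i j
  rw [hval]
  obtain ⟨c, hc⟩ := hirr.exists_eq_smul_one (P := P (i, j)) fun g => by
    have h := hP (f g) (f g).2 (hinv g) (i, j)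
    conv_rhs => rw [← h]
    rw [Matrix.mul_assoc _ _ (f g : Matrix a a ℂ), conjTranspose_mul_self_of_mem (f g).2, mul_one]
  have ht := htrace (Matrix.single i j 1)
  rw [hval, hc, Matrix.trace_smul, Matrix.trace_one, smul_eq_mul] at ht
  have hcard : (Fintype.card a : ℂ) ≠ 0 := by simp
  rw [hc, replaceMap_apply, maxMixed, smul_smul, ← ht, mul_assoc, mul_inv_cancel₀ hcard, mul_one]

end Twirl

/-! ### Assisted capacities of covariant channels -/

section Covariant

variable {G : Type*} {a b e r : Type*} [Fintype a] [DecidableEq a] [Fintype b]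
  [DecidableEq b] [Fintype e] [DecidableEq e] [Fintype r] [DecidableEq r]
  {fA : G → Matrix.unitaryGroup a ℂ} {fB : G → Matrix.unitaryGroup b ℂ}
  {N : Matrix a a ℂ →ₗ[ℂ] Matrix b b ℂ} {n : ℕ} {p : Fin n → ℝ} {g : Fin n → G}

lemma IsCovariant.comp_conjMap (hcov : IsCovariant fA fB N) (h : G) :
    N ∘ₗ conjMap (fA h : Matrix a a ℂ) = conjMap (fB h : Matrix b b ℂ) ∘ₗ N :=
  LinearMap.ext fun M => hcov h M

/-- For a channel that is covariant with respect to an irreducible representation, the maximally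
mixed input has the largest output entropy. -/
lemma IsCovariant.entropy_apply_le (hcov : IsCovariant fA fB N) (hN : IsChannel N)
    (hp : ∀ x, 0 ≤ p x) (hp1 : ∑ x, p x = 1)
    (htwirl : ∑ x, (p x : ℂ) • conjMap (fA (g x) : Matrix a a ℂ) = replaceMap a (maxMixed a))
    {σ : Matrix a a ℂ} (hσ : IsState σ) : entropy (N σ) ≤ entropy (N (maxMixed a)) := by
  have hNσ := (hN.isState_apply hσ).posSemidef
  have hav : N (maxMixed a)
      = ∑ x, (p x : ℂ) • ((fB (g x) : Matrix b b ℂ) * N σ * (fB (g x) : Matrix b b ℂ)ᴴ) := by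
    have h1 : replaceMap a (maxMixed a) σ = maxMixed a := by
      rw [replaceMap_apply, hσ.trace_eq_one, one_smul]
    rw [← h1, ← htwirl, LinearMap.sum_apply, map_sum]
    refine Finset.sum_congr rfl fun x _ => ?_
    rw [LinearMap.smul_apply, map_smul, conjMap_apply, hcov]
  have hconc := sum_smul_entropy_le hp hp1
    (σ := fun x => (fB (g x) : Matrix b b ℂ) * N σ * (fB (g x) : Matrix b b ℂ)ᴴ)
    fun x => hNσ.mul_mul_conjTranspose_same _
  rw [← hav] at hconc
  simpa only [fun x => entropy_conj_unitary (fB (g x)).2 hNσ.isHermitian, ← Finset.sum_mul, hp1,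
    one_mul] using hconc

lemma IsCovariant.entropy_tensorId_conjMap (hcov : IsCovariant fA fB N) (hN : IsChannel N)
    {M : Matrix (a × r) (a × r) ℂ} (hM : M.PosSemidef) (h : G) :
    entropy (tensorId N r (tensorId (conjMap (fA h : Matrix a a ℂ)) r M))
      = entropy (tensorId N r M) := by
  rw [tensorId_comp, hcov.comp_conjMap, ← tensorId_comp, tensorId_conjMap]
  exact entropy_conj_unitary (Matrix.kronecker_mem_unitary (fB h).2 (one_mem _))
    (hN.posSemidef_tensorId hM).isHermitian

lemma isState_output {ρ : Matrix (e × r) (e × r) ℂ} (hρ : IsState ρ) (hN : IsChannel N)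
    {E : Matrix e e ℂ →ₗ[ℂ] Matrix a a ℂ} (hE : IsChannel E) :
    IsState (tensorId N r (tensorId E r ρ)) :=
  hN.isState_tensorId (hE.isState_tensorId hρ)

/-- For every ensemble the average output on `B` has at most the entropy of
the image of the maximally mixed state. -/
lemma IsCovariant.entropy_marginalFst_average_le (hcov : IsCovariant fA fB N) (hN : IsChannel N)
    (hp : ∀ x, 0 ≤ p x) (hp1 : ∑ x, p x = 1)
    (htwirl : ∑ x, (p x : ℂ) • conjMap (fA (g x) : Matrix a a ℂ) = replaceMap a (maxMixed a))
    {ρ : Matrix (e × r) (e × r) ℂ} (hρ : IsState ρ) {m : ℕ} {w : Fin m → ℝ}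
    (hw : ∀ x, 0 ≤ w x) (hw1 : ∑ x, w x = 1) {E : Fin m → Matrix e e ℂ →ₗ[ℂ] Matrix a a ℂ}
    (hE : ∀ x, IsChannel (E x)) :
    entropy (marginalFst (∑ x, (w x : ℂ) • tensorId N r (tensorId (E x) r ρ)))
      ≤ entropy (N (maxMixed a)) := by
  have h : ∑ x, (w x : ℂ) • tensorId N r (tensorId (E x) r ρ)
      = tensorId N r (∑ x, (w x : ℂ) • tensorId (E x) r ρ) := by
    simp [map_sum]
  rw [h, marginalFst_tensorId]
  exact hcov.entropy_apply_le hN hp hp1 htwirl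
    (isState_marginalFst (isState_sum_smul hw hw1 fun x => (hE x).isState_tensorId hρ))

lemma marginalSnd_average {ρ : Matrix (e × r) (e × r) ℂ} (hN : IsChannel N) {m : ℕ}
    {w : Fin m → ℝ} (hw1 : ∑ x, w x = 1) {E : Fin m → Matrix e e ℂ →ₗ[ℂ] Matrix a a ℂ}
    (hE : ∀ x, IsChannel (E x)) :
    marginalSnd (∑ x, (w x : ℂ) • tensorId N r (tensorId (E x) r ρ)) = marginalSnd ρ := by
  have h : marginalSnd (∑ x, (w x : ℂ) • tensorId N r (tensorId (E x) r ρ))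
      = ∑ x, (w x : ℂ) • marginalSnd (tensorId N r (tensorId (E x) r ρ)) := by
    ext i j
    simp only [marginalSnd, Matrix.of_apply, Matrix.sum_apply, Matrix.smul_apply, smul_eq_mul,
      Finset.mul_sum]
    exact Finset.sum_comm
  have hx : ∀ x, marginalSnd (tensorId (E x) r ρ) = marginalSnd ρ := fun x =>
    (hE x).marginalSnd_tensorId ρ
  simp only [h, hN.marginalSnd_tensorId, hx]
  rw [← Finset.sum_smul, ← Complex.ofReal_sum, hw1, Complex.ofReal_one, one_smul]

/-- Encoding by any fixed channel followed by a twirl makes the average output the product of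
`N π` and the assisting marginal. -/
lemma average_twirled_output (N : Matrix a a ℂ →ₗ[ℂ] Matrix b b ℂ)
    (htwirl : ∑ x, (p x : ℂ) • conjMap (fA (g x) : Matrix a a ℂ) = replaceMap a (maxMixed a))
    {E : Matrix e e ℂ →ₗ[ℂ] Matrix a a ℂ} (hE : IsChannel E) (ρ : Matrix (e × r) (e × r) ℂ) :
    ∑ x, (p x : ℂ) •
        tensorId N r (tensorId (conjMap (fA (g x) : Matrix a a ℂ) ∘ₗ E) r ρ)
      = N (maxMixed a) ⊗ₖ marginalSnd ρ := by
  have h : ∑ x, (p x : ℂ) • tensorId N r (tensorId (conjMap (fA (g x) : Matrix a a ℂ) ∘ₗ E) r ρ)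
      = tensorId N r (∑ x, (p x : ℂ) •
          tensorId (conjMap (fA (g x) : Matrix a a ℂ)) r (tensorId E r ρ)) := by
    simp [map_sum, tensorId_comp]
  have hrep : N ∘ₗ replaceMap a (maxMixed a) = replaceMap a (N (maxMixed a)) :=
    LinearMap.ext fun M => by simp [replaceMap_apply]
  rw [h, ← tensorId_sum_smul, htwirl, tensorId_comp, hrep, tensorId_replaceMap,
    hE.marginalSnd_tensorId]

end Covariant

end QInfo

open QInfo in
theorem mainTheorem5 {G : Type*} [Group G] [TopologicalSpace G] [IsTopologicalGroup G]
    [CompactSpace G] {a b eA eB : Type*} [Fintype a] [DecidableEq a] [Fintype b] [DecidableEq b]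
    [Fintype eA] [DecidableEq eA] [Fintype eB] [DecidableEq eB]
    (fA : G → Matrix.unitaryGroup a ℂ) (fB : G → Matrix.unitaryGroup b ℂ)
    (hfA : QInfo.IsProjectiveRep fA) (hfB : QInfo.IsProjectiveRep fB)
    (hirr : QInfo.IsIrreducibleRep fA)
    (N : Matrix a a ℂ →ₗ[ℂ] Matrix b b ℂ) (hN : QInfo.IsChannel N)
    (hcov : QInfo.IsCovariant fA fB N)
    (ρ : Matrix (eA × eB) (eA × eB) ℂ) (hρ : QInfo.IsState ρ) :
    IsGreatest (QInfo.holevoValues ρ N) (QInfo.assistedHolevo ρ N) ∧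
    IsGreatest (QInfo.mutualValues ρ N) (QInfo.assistedMutual ρ N) ∧
    IsLeast (QInfo.outputEntropies ρ N) (QInfo.minOutputEntropy ρ N) ∧
    QInfo.assistedHolevo ρ N = QInfo.assistedMutual ρ N ∧
    QInfo.assistedMutual ρ N =
      QInfo.entropy (N (QInfo.maxMixed a)) + QInfo.entropy (QInfo.marginalSnd ρ)
        - QInfo.minOutputEntropy ρ N := by
  have := hirr.nonempty
  obtain ⟨n, p, g, hp, hp1, htwirl⟩ := exists_twirl hfA hirr
  obtain ⟨E, hE, hleast⟩ := exists_isLeast_outputEntropies hρ hN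
  have hmin : minOutputEntropy ρ N = entropy (tensorId N eB (tensorId E eB ρ)) :=
    hleast.csInf_eq
  set m := entropy (tensorId N eB (tensorId E eB ρ)) with hm
  have hτ := isState_marginalSnd hρ
  have hNπ := hN.isState_apply (isState_maxMixed (a := a))
  have hlower : ∀ (k : ℕ) (w : Fin k → ℝ) (F : Fin k → Matrix eA eA ℂ →ₗ[ℂ] Matrix a a ℂ),
      (∀ x, 0 ≤ w x) → ∑ x, w x = 1 → (∀ x, IsChannel (F x)) →
      m ≤ ∑ x, w x * entropy (tensorId N eB (tensorId (F x) eB ρ)) := by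
    intro k w F hw hw1 hF
    calc m = ∑ x, w x * m := by rw [← Finset.sum_mul, hw1, one_mul]
      _ ≤ _ := Finset.sum_le_sum fun x _ =>
        mul_le_mul_of_nonneg_left (hleast.2 ⟨F x, hF x, rfl⟩) (hw x)
  -- The ensemble attaining both maxima: an optimal encoding followed by the twirl.
  set F : Fin n → Matrix eA eA ℂ →ₗ[ℂ] Matrix a a ℂ :=
    fun x => conjMap (fA (g x) : Matrix a a ℂ) ∘ₗ E with hFdef
  have hF : ∀ x, IsChannel (F x) := fun x => (isChannel_conjMap (fA (g x)).2).comp hE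
  have hav : ∑ x, (p x : ℂ) • tensorId N eB (tensorId (F x) eB ρ)
      = N (maxMixed a) ⊗ₖ marginalSnd ρ := average_twirled_output N htwirl hE ρ
  have hent : ∑ x, p x * entropy (tensorId N eB (tensorId (F x) eB ρ)) = m := by
    simp only [hFdef, ← tensorId_comp, fun x => hcov.entropy_tensorId_conjMap hN
      (hE.isState_tensorId hρ).posSemidef (g x), ← Finset.sum_mul, hp1, one_mul, hm]
  have hmargF : marginalFst (N (maxMixed a) ⊗ₖ marginalSnd ρ) = N (maxMixed a) := by
    ext i j
    have := hτ.trace_eq_one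
    rw [Matrix.trace] at this
    simp only [Matrix.diag_apply] at this
    simp [marginalFst, ← Finset.mul_sum, this]
  have hχ : IsGreatest (holevoValues ρ N)
      (entropy (N (maxMixed a)) + entropy (marginalSnd ρ) - m) := by
    constructor
    · refine ⟨n, _, ⟨p, F, hp, hp1, hF, rfl⟩, ?_⟩
      rw [mutualInfo_cqState hp fun x => isState_output hρ hN (hF x), hav, hent,
        entropy_kronecker hNπ.posSemidef.isHermitian hτ.posSemidef.isHermitian hNπ.trace_eq_one
          hτ.trace_eq_one]
    · rintro _ ⟨k, _, ⟨w, D, hw, hw1, hD, rfl⟩, rfl⟩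
      rw [mutualInfo_cqState hw fun x => isState_output hρ hN (hD x)]
      have h1 := entropy_le_add_marginals
        (isState_sum_smul hw hw1 fun x => isState_output hρ hN (hD x))
      rw [marginalSnd_average hN hw1 hD] at h1
      linarith [hcov.entropy_marginalFst_average_le hN hp hp1 htwirl hρ hw hw1 hD,
        hlower k w D hw hw1 hD]
  have hmarg : ∀ D : Matrix eA eA ℂ →ₗ[ℂ] Matrix a a ℂ, IsChannel D →
      marginalSnd (tensorId N eB (tensorId D eB ρ)) = marginalSnd ρ := fun D hD => by
    rw [hN.marginalSnd_tensorId, hD.marginalSnd_tensorId]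
  have hI : IsGreatest (mutualValues ρ N)
      (entropy (N (maxMixed a)) + entropy (marginalSnd ρ) - m) := by
    constructor
    · refine ⟨n, _, ⟨p, F, hp, hp1, hF, rfl⟩, ?_⟩
      rw [mutualInfo_regroup_cqState hp hp1 (fun x => isState_output hρ hN (hF x)) hτ
        fun x => hmarg _ (hF x), hav, hent, hmargF]
    · rintro _ ⟨k, _, ⟨w, D, hw, hw1, hD, rfl⟩, rfl⟩
      rw [mutualInfo_regroup_cqState hw hw1 (fun x => isState_output hρ hN (hD x)) hτ
        fun x => hmarg _ (hD x)]
      linarith [hcov.entropy_marginalFst_average_le hN hp hp1 htwirl hρ hw hw1 hD,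
        hlower k w D hw hw1 hD]
  have hχeq : assistedHolevo ρ N = _ := hχ.csSup_eq
  have hIeq : assistedMutual ρ N = _ := hI.csSup_eq
  rw [hχeq, hIeq, hmin]
  exact ⟨hχ, hI, hleast, rfl, rfl⟩
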